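/- For a finite simple graph $G=(V,E)$ and $x>0$ let $Z_G(x)=\sum_{D}x^{|V|-2|D|}$, the sum being over all sets $D\subseteq E$ of pairwise vertex-disjoint edges; let $p_G(x)=\frac{1}{|V|}\log Z_G(x)$ be the pressure per particle and $\varepsilon_G(x)=x\,\frac{\partial}{\partial x}\,p_G(x)$ the monomer density. Let $[G,v]_r$ be the subgraph induced by the vertices at distance at most $r$ from $v$. Let $P,\rho$ be probability distributions on $\mathbb N=\{0,1,2,\dots\}$ such that $\overline P:=\sum_k kP_k<\infty$ and $\overline P\,\rho_k=(k+1)P_{k+1}$ for all $k$. Let $\mathcal T(P,\rho)$ be the (unimodular) Galton–Watson tree in which the numbers of sons of the vertices are independent, with distribution $P$ for the root $o$ and $\rho$ for all other vertices, and let $\mathcal T(P,\rho,r)$ be its subtree formed by the root and the first $r$ generations. Let $(G_n)_{n\in\mathbb N}$, $G_n=(V_n,E_n)$, be a sequence of random finite simple graphs on a common probability space, and suppose that: (i) $(G_n)$ converges locally to $\mathcal T(P,\rho)$: for every $r\in\mathbb N$ and every finite rooted tree $(T,o)$ with at most $r$ generations, almost surely $$\frac{1}{|V_n|}\,\big|\{v\in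 V_n : ([G_n,v]_r,v)\cong(T,o)\}\big|\ \longrightarrow\ \mathbb P\big((\mathcal T(P,\rho,r),o)\cong(T,o)\big)\qquad(n\to\infty),$$ where $\cong$ denotes isomorphism of rooted graphs; (ii) $P$ has a finite second moment, $\sum_k k^2P_k<\infty$; (iii) $(G_n)$ is uniformly sparse: almost surely $$\lim_{l\to\infty}\limsup_{n\to\infty}\frac{1}{|V_n|}\sum_{v\in V_n}\deg_{G_n}(v)\,\mathbf 1\big(\deg_{G_n}(v)\ge l\big)=0.$$ If $\overline P>0$, then the limiting pressure is an analytic function of the limiting monomer density. That is, there are deterministic functions $\varepsilon,p$ on $(0,\infty)$ such that almost surely, for all $x>0$, $$\lim_{n\to\infty}\varepsilon_{G_n}(x)=\varepsilon(x),\qquad \lim_{n\to\infty}\frac{1}{|V_n|}\log Z_{G_n}(x)=p(x);$$ the function $\varepsilon$ is real-analytic on $(0,\infty)$ with $\varepsilon'(x)>0$ for all $x>0$; and there is a function $F$, real-analytic in a neighbourhood of each point of $\varepsilon\big((0,\infty)\big)$, such that $p(x)=F(\varepsilon(x))$ for all $x>0$. -/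

import Mathlib

namespace MonomerDimer

open scoped ENNReal
open MeasureTheory

section Model

variable {V : Type*} [Fintype V]

open Classical in
/-- The dimeric configurations on a finite simple graph `G`: the sets of edges of `G`,
no two of which have a vertex in common. -/
noncomputable def dimericConfigs (G : SimpleGraph V) : Finset (Finset (Sym2 V)) :=
  G.edgeFinset.powerset.filter
    (fun D => ∀ e ∈ D, ∀ f ∈ D, e ≠ f → ∀ v : V, ¬ (v ∈ e ∧ v ∈ f))

/-- The partition function `Z_G(x) = ∑_D x ^ (|V| - 2 |D|)`, the sum being over the dimeric
configurations `D`. (The subtraction never truncates, as `2 |D| ≤ |V|`.) -/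
noncomputable def partitionFunction (G : SimpleGraph V) (x : ℝ) : ℝ :=
  ∑ D ∈ dimericConfigs G, x ^ (Fintype.card V - 2 * D.card)

/-- The pressure per particle `log Z_G(x) / |V|`. -/
noncomputable def pressure (G : SimpleGraph V) (x : ℝ) : ℝ :=
  Real.log (partitionFunction G x) / Fintype.card V

/-- The monomer density `ε_G(x) = x ∂/∂x (log Z_G(x) / |V|)`. -/
noncomputable def monomerDensity (G : SimpleGraph V) (x : ℝ) : ℝ :=
  x * deriv (pressure G) x

end Model

section RootedGraphs

/-- The vertices at graph-distance at most `r` from `o`. -/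
def ballVertices {V : Type*} (G : SimpleGraph V) (o : V) (r : ℕ) : Set V :=
  {v | G.edist o v ≤ r}

theorem center_mem_ballVertices {V : Type*} (G : SimpleGraph V) (o : V) (r : ℕ) :
    o ∈ ballVertices G o r := by
  simp [ballVertices]

/-- The ball `[G, o]_r`, the subgraph induced by the vertices at distance at most `r`. -/
def ball {V : Type*} (G : SimpleGraph V) (o : V) (r : ℕ) : SimpleGraph (ballVertices G o r) :=
  G.induce (ballVertices G o r)

/-- The center of the ball `[G, o]_r`, as a vertex of it. -/
def ballCenter {V : Type*} (G : SimpleGraph V) (o : V) (r : ℕ) : ballVertices G o r :=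
  ⟨o, center_mem_ballVertices G o r⟩

/-- The rooted graphs `(G, o)` and `(H, o')` are isomorphic. -/
def RootedIso {V W : Type*} (G : SimpleGraph V) (o : V) (H : SimpleGraph W) (o' : W) : Prop :=
  ∃ φ : G ≃g H, φ o = o'

end RootedGraphs

section GaltonWatson

/-- Potential vertices of a Galton-Watson tree are finite words of natural numbers: the root is
the empty word and `u ++ [i]` is the `i`-th son of `u` (counted from `0`). If `K u` is the number
of sons of `u`, the word `v` is present in the tree when each of its letters is smaller than the
number of sons of the word before that letter. -/
def IsTreeVertex (K : List ℕ → ℕ) (v : List ℕ) : Prop :=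
  ∀ (u : List ℕ) (i : ℕ), u ++ [i] <+: v → i < K u

theorem isTreeVertex_nil (K : List ℕ → ℕ) : IsTreeVertex K [] := by
  intro u i h
  simp at h

/-- The tree with offspring numbers `K`: each vertex is connected to its sons. -/
def offspringTree (K : List ℕ → ℕ) : SimpleGraph {v : List ℕ // IsTreeVertex K v} where
  Adj v w := (∃ i : ℕ, w.1 = v.1 ++ [i]) ∨ (∃ i : ℕ, v.1 = w.1 ++ [i])
  symm := ⟨fun _ _ h => h.symm⟩
  loopless := ⟨fun v h => by
    rcases h with ⟨i, hi⟩ | ⟨i, hi⟩ <;> simp at hi⟩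

/-- The root of the tree with offspring numbers `K`. -/
def treeRoot (K : List ℕ → ℕ) : {v : List ℕ // IsTreeVertex K v} :=
  ⟨[], isTreeVertex_nil K⟩

/-- The law of the offspring numbers of the Galton-Watson tree `T(P, ρ)`: they are independent,
with distribution `P` at the root and `ρ` at every other vertex. -/
noncomputable def offspringLaw (P ρ : PMF ℕ) : Measure (List ℕ → ℕ) :=
  Measure.infinitePi (fun v : List ℕ => (if v = [] then P else ρ).toMeasure)

/-- The probability that the truncated Galton-Watson tree `T(P, ρ, r)` is isomorphic, as a rooted
graph, to `(T, o)`. -/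
noncomputable def truncatedTreeProb (P ρ : PMF ℕ) (r : ℕ) {W : Type*}
    (T : SimpleGraph W) (o : W) : ℝ :=
  (offspringLaw P ρ).real
    {K | RootedIso (ball (offspringTree K) (treeRoot K) r)
      (ballCenter (offspringTree K) (treeRoot K) r) T o}

/-- The mean `∑ k P_k` of a distribution on `ℕ`. -/
noncomputable def mean (P : PMF ℕ) : ℝ≥0∞ := ∑' k : ℕ, (k : ℝ≥0∞) * P k

/-- The second moment `∑ k² P_k` of a distribution on `ℕ`. -/
noncomputable def secondMoment (P : PMF ℕ) : ℝ≥0∞ := ∑' k : ℕ, (k : ℝ≥0∞) ^ 2 * P k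

/-- `T(P, ρ)` is unimodular: `P` has a finite mean `m`, and `m ρ_k = (k + 1) P_{k + 1}` for
all `k`, that is, `ρ_k = (k + 1) P_{k + 1} / m` when `m > 0`. -/
def IsUnimodular (P ρ : PMF ℕ) : Prop :=
  mean P ≠ ∞ ∧ ∀ k : ℕ, mean P * ρ k = ((k : ℝ≥0∞) + 1) * P (k + 1)

end GaltonWatson

section RandomGraphs

/-- A finite simple graph, with vertices labelled by `0, …, card - 1`. -/
structure FinGraph where
  /-- The number of vertices. -/
  card : ℕ
  /-- The graph on the vertices. -/
  graph : SimpleGraph (Fin card)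

/-- Finite labelled graphs form a countable set, which carries the discrete `σ`-algebra. -/
instance : MeasurableSpace FinGraph := ⊤

open Classical in
/-- The proportion of the vertices `v` of `G` for which `([G, v]_r, v)` is isomorphic to
`(T, o)`. -/
noncomputable def ballFrequency (G : FinGraph) (r : ℕ) {W : Type*} (T : SimpleGraph W) (o : W) :
    ℝ :=
  ((Finset.univ.filter (fun v : Fin G.card =>
    RootedIso (ball G.graph v r) (ballCenter G.graph v r) T o)).card : ℝ) / G.card

variable {Ω : Type*} [MeasurableSpace Ω]

/-- The random graphs `G n` converge locally to the Galton-Watson tree `T(P, ρ)`: for every `r` and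
every finite rooted tree `(T, o)` with at most `r` generations, almost surely the proportion of
vertices with ball of radius `r` isomorphic to `(T, o)` tends to the probability that `T(P, ρ, r)`
is isomorphic to `(T, o)`. -/
def LocallyConverges (μ : Measure Ω) (G : ℕ → Ω → FinGraph) (P ρ : PMF ℕ) : Prop :=
  ∀ (r m : ℕ) (T : SimpleGraph (Fin m)) (o : Fin m), T.IsTree → (∀ v, T.dist o v ≤ r) →
    ∀ᵐ ω ∂μ, Filter.Tendsto (fun n => ballFrequency (G n ω) r T o) Filter.atTop
      (nhds (truncatedTreeProb P ρ r T o))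

open Classical in
/-- The average over the vertices `v` of `G` of `deg v` if `deg v ≥ l` and of `0` otherwise. -/
noncomputable def highDegreeAverage (G : FinGraph) (l : ℕ) : ℝ≥0∞ :=
  ((∑ v : Fin G.card, if l ≤ G.graph.degree v then G.graph.degree v else 0 : ℕ) : ℝ≥0∞) / G.card

/-- The random graphs `G n` are uniformly sparse. -/
def UniformlySparse (μ : Measure Ω) (G : ℕ → Ω → FinGraph) : Prop :=
  ∀ᵐ ω ∂μ, Filter.Tendsto
    (fun l : ℕ => Filter.limsup (fun n => highDegreeAverage (G n ω) l) Filter.atTop)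
    Filter.atTop (nhds 0)

end RandomGraphs

end MonomerDimer

namespace MonomerDimer

open scoped ENNReal
open MeasureTheory

/-! Write `Q = Z(S \ v) / Z(S)`, so that `x Q` is the probability that `v` is a monomer. The
Heilmann-Lieb recursion becomes `Q = 1 / (x + ∑ Q_w)`, the sum over the neighbours `w` of `v` with
ratios taken in `S \ v` (`ratio_rec`), and the monomer density is the average of `x Q_v` over the
vertices.

Large activities. Each use of the recursion damps a perturbation by `x⁻²`, so changing the graph
beyond distance `r` from `v` alters `x Q_v` by at most `x^(-2r)` times the number of self-avoiding
walks of length `r` (`abs_ratio_sub_ratio_le`). In the Galton-Watson tree that number has mean at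
most `mean P * mean ρ ^ (r - 1)` for `r ≥ 1`, and the second moment makes `mean ρ` finite. Hence for
`x² > mean ρ` the densities converge, to a limit that depends on `P` and `ρ` alone.

All activities. The densities are holomorphic in the right half-plane and bounded there
independently of the graph (`norm_complexDensity_le`). Vitali's theorem on discs with a large center
`X` and radius less than `X` carries the convergence to every `x > 0` and makes the limit `ε`
holomorphic near the positive axis.

Positive derivative. The recursion gives `Q + x Q' ≥ 0`, with an explicit positive lower bound
depending only on the ball of radius 2 when `v` has a neighbour. Since `mean P > 0`, some such ball
has positive limiting frequency, so increments of `ε` are bounded below (`deriv_limit_pos`).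

Pressure. For a finite graph `p(x) = log x + ∫_x^∞ (1 - ε(t)) / t dt`, and bounded average degree
dominates the integrand by `C t⁻³`. The limiting pressure therefore has the same form, satisfies `p'
= ε / x`, and is analytic. As `ε' > 0`, the function `F = p ∘ ε⁻¹` is analytic. -/

set_option linter.unusedSectionVars false

/-! ### The partition function of vertex subsets and its recursion. -/

section Recursion

open Classical in
/-- The dimeric configurations of the subgraph of `G` induced by `S`. -/
noncomputable def configsOn {V : Type*} [Fintype V] (G : SimpleGraph V) (S : Finset V) :
    Finset (Finset (Sym2 V)) :=
  (dimericConfigs G).filter (fun D => ∀ e ∈ D, ∀ v ∈ e, v ∈ S)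

/-- The partition function of the subgraph of `G` induced by `S`. -/
noncomputable def partitionOn {V : Type*} [Fintype V] {R : Type*} [CommSemiring R]
    (G : SimpleGraph V) (S : Finset V) (x : R) : R :=
  ∑ D ∈ configsOn G S, x ^ (S.card - 2 * D.card)

open Classical in
/-- The neighbours of `v` that lie in `S`. -/
noncomputable def nbrs {V : Type*} (G : SimpleGraph V) (S : Finset V) (v : V) : Finset V :=
  S.filter (fun w => G.Adj v w)

theorem mem_nbrs {V : Type*} {G : SimpleGraph V} {S : Finset V} {v w : V} :
    w ∈ nbrs G S v ↔ w ∈ S ∧ G.Adj v w := by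
  simp [nbrs]

theorem nbrs_erase_self {V : Type*} [DecidableEq V] {G : SimpleGraph V} {S : Finset V} {v : V} :
    nbrs G (S.erase v) v = nbrs G S v := by
  ext w
  simp only [mem_nbrs, Finset.mem_erase]
  exact ⟨fun h => ⟨h.1.2, h.2⟩, fun h => ⟨⟨h.2.ne', h.1⟩, h.2⟩⟩

variable {V : Type*} [Fintype V] {R : Type*} [CommSemiring R]
  {G : SimpleGraph V} {S : Finset V}

theorem mem_configsOn {D : Finset (Sym2 V)} : D ∈ configsOn G S ↔
    (∀ e ∈ D, e ∈ G.edgeSet) ∧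
    (∀ e ∈ D, ∀ f ∈ D, e ≠ f → ∀ v : V, ¬ (v ∈ e ∧ v ∈ f)) ∧ ∀ e ∈ D, ∀ v ∈ e, v ∈ S := by
  classical
  unfold configsOn dimericConfigs
  rw [Finset.mem_filter, Finset.mem_filter, Finset.mem_powerset, and_assoc, Finset.subset_iff]
  simp only [SimpleGraph.mem_edgeFinset]

/-- Disjoint edges occupy two vertices each. This keeps the natural subtraction in the exponents
exact. -/
theorem two_mul_card_le {D : Finset (Sym2 V)} (hD : D ∈ configsOn G S) :
    2 * D.card ≤ S.card := by
  classical
  rw [mem_configsOn] at hD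
  obtain ⟨h1, h2, h3⟩ := hD
  have h4 : (D.biUnion (fun e => S.filter (fun v => v ∈ e))).card = ∑ e ∈ D, 2 := by
    rw [Finset.card_biUnion]
    · refine Finset.sum_congr rfl fun e he => ?_
      have hd : ¬ e.IsDiag := G.not_isDiag_of_mem_edgeSet (h1 e he)
      rw [← Sym2.card_toFinset_of_not_isDiag e hd]
      congr 1
      ext v
      simp only [Finset.mem_filter, Sym2.mem_toFinset]
      exact ⟨fun h => h.2, fun h => ⟨h3 e he v h, h⟩⟩
    · intro e he f hf hef
      rw [Function.onFun, Finset.disjoint_left]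
      intro v hv hv'
      exact h2 e he f hf hef v ⟨(Finset.mem_filter.1 hv).2, (Finset.mem_filter.1 hv').2⟩
  have h5 : (D.biUnion (fun e => S.filter (fun v => v ∈ e))).card ≤ S.card :=
    Finset.card_le_card (Finset.biUnion_subset.2 fun e _ => Finset.filter_subset _ _)
  rw [h4, Finset.sum_const, smul_eq_mul] at h5
  omega

theorem partitionOn_univ (x : ℝ) : partitionOn G Finset.univ x = partitionFunction G x := by
  classical
  have : configsOn G Finset.univ = dimericConfigs G :=
    Finset.filter_true_of_mem fun _ _ _ _ v _ => Finset.mem_univ v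
  rw [partitionOn, this, partitionFunction, Finset.card_univ]

theorem partitionOn_empty (x : R) : partitionOn G ∅ x = 1 := by
  classical
  have : configsOn G ∅ = {∅} := by
    ext D
    rw [Finset.mem_singleton]
    constructor
    · intro h
      have := two_mul_card_le h
      simpa using this
    · rintro rfl
      simp [mem_configsOn]
  simp [partitionOn, this]

theorem map_partitionOn {R' : Type*} [CommSemiring R'] (f : R →+* R') (x : R) :
    partitionOn G S (f x) = f (partitionOn G S x) := by
  simp [partitionOn]

variable [DecidableEq V]

theorem mem_configsOn_erase {v : V} {D : Finset (Sym2 V)} :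
    D ∈ configsOn G (S.erase v) ↔ D ∈ configsOn G S ∧ ∀ e ∈ D, v ∉ e := by
  simp only [mem_configsOn, Finset.mem_erase]
  constructor
  · rintro ⟨h1, h2, h3⟩
    exact ⟨⟨h1, h2, fun e he w hw => (h3 e he w hw).2⟩, fun e he hv => (h3 e he v hv).1 rfl⟩
  · rintro ⟨⟨h1, h2, h3⟩, h4⟩
    exact ⟨h1, h2, fun e he w hw => ⟨fun h => h4 e he (h ▸ hw), h3 e he w hw⟩⟩

theorem insert_mem_configsOn {v w : V} (hv : v ∈ S) (hw : w ∈ nbrs G S v)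
    {D : Finset (Sym2 V)} (hD : D ∈ configsOn G ((S.erase v).erase w)) :
    insert s(v, w) D ∈ configsOn G S ∧ s(v, w) ∉ D := by
  rw [mem_configsOn_erase, mem_configsOn_erase] at hD
  obtain ⟨⟨hD, hDv⟩, hDw⟩ := hD
  rw [mem_configsOn] at hD
  obtain ⟨h1, h2, h3⟩ := hD
  rw [mem_nbrs] at hw
  refine ⟨mem_configsOn.2 ⟨?_, ?_, ?_⟩, fun h => hDv _ h (by simp)⟩
  · intro e he
    rcases Finset.mem_insert.1 he with rfl | he
    · exact hw.2
    · exact h1 e he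
  · have key : ∀ f ∈ D, ∀ u : V, ¬ (u ∈ s(v, w) ∧ u ∈ f) := by
      rintro f hf u ⟨hu, huf⟩
      rcases Sym2.mem_iff.1 hu with rfl | rfl
      · exact hDv f hf huf
      · exact hDw f hf huf
    intro e he f hf hef u hu
    rcases Finset.mem_insert.1 he with rfl | he <;> rcases Finset.mem_insert.1 hf with rfl | hf
    · exact hef rfl
    · exact key f hf u hu
    · exact key e he u hu.symm
    · exact h2 e he f hf hef u hu
  · intro e he u hu
    rcases Finset.mem_insert.1 he with rfl | he
    · rcases Sym2.mem_iff.1 hu with rfl | rfl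
      · exact hv
      · exact hw.1
    · exact h3 e he u hu

theorem erase_mem_configsOn {v w : V} {D : Finset (Sym2 V)} (hD : D ∈ configsOn G S)
    (he : s(v, w) ∈ D) : D.erase s(v, w) ∈ configsOn G ((S.erase v).erase w) := by
  obtain ⟨h1, h2, h3⟩ := mem_configsOn.1 hD
  rw [mem_configsOn_erase, mem_configsOn_erase, mem_configsOn]
  refine ⟨⟨⟨fun e he => h1 e (Finset.mem_of_mem_erase he),
    fun e he f hf => h2 e (Finset.mem_of_mem_erase he) f (Finset.mem_of_mem_erase hf),
    fun e he => h3 e (Finset.mem_of_mem_erase he)⟩, ?_⟩, ?_⟩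
  · intro e he' hv
    exact h2 e (Finset.mem_of_mem_erase he') _ he (Finset.ne_of_mem_erase he') v ⟨hv, by simp⟩
  · intro e he' hv
    exact h2 e (Finset.mem_of_mem_erase he') _ he (Finset.ne_of_mem_erase he') w ⟨hv, by simp⟩

/-- The Heilmann-Lieb recursion. -/
theorem partitionOn_rec {v : V} (hv : v ∈ S) (x : R) :
    partitionOn G S x = x * partitionOn G (S.erase v) x +
      ∑ w ∈ nbrs G S v, partitionOn G ((S.erase v).erase w) x := by
  classical
  rw [partitionOn, ← Finset.sum_filter_add_sum_filter_not (configsOn G S)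
    (fun D => ∀ e ∈ D, v ∉ e)]
  congr 1
  · have : (configsOn G S).filter (fun D => ∀ e ∈ D, v ∉ e) = configsOn G (S.erase v) := by
      ext D
      rw [Finset.mem_filter, mem_configsOn_erase]
    rw [this, partitionOn, Finset.mul_sum]
    refine Finset.sum_congr rfl fun D hD => ?_
    rw [← pow_succ']
    congr 1
    have h1 := two_mul_card_le hD
    rw [Finset.card_erase_of_mem hv] at *
    have := Finset.card_pos.2 ⟨v, hv⟩
    omega
  · simp only [partitionOn]
    rw [Finset.sum_sigma']
    symm
    refine Finset.sum_bij (fun p _ => insert s(v, p.1) p.2) ?_ ?_ ?_ ?_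
    · rintro ⟨w, D⟩ h
      obtain ⟨hw, hD⟩ := Finset.mem_sigma.1 h
      obtain ⟨h1, h2⟩ := insert_mem_configsOn hv hw hD
      rw [Finset.mem_filter]
      refine ⟨h1, fun h => h _ (Finset.mem_insert_self _ _) (by simp)⟩
    · rintro ⟨w, D⟩ h ⟨w', D'⟩ h' heq
      obtain ⟨hw, hD⟩ := Finset.mem_sigma.1 h
      obtain ⟨hw', hD'⟩ := Finset.mem_sigma.1 h'
      obtain ⟨h1, h2⟩ := insert_mem_configsOn hv hw hD
      obtain ⟨h1', h2'⟩ := insert_mem_configsOn hv hw' hD'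
      dsimp only at *
      have hww : w = w' := by
        have h3 : s(v, w) ∈ insert s(v, w') D' := heq ▸ Finset.mem_insert_self _ _
        rcases Finset.mem_insert.1 h3 with h3 | h3
        · exact Sym2.congr_right.1 h3
        · exact absurd (Sym2.mem_mk_left v w)
            ((mem_configsOn_erase.1 (mem_configsOn_erase.1 hD').1).2 _ h3)
      subst hww
      have : D = D' := by
        rw [← Finset.erase_insert h2, heq, Finset.erase_insert h2']
      rw [this]
    · intro D hD
      rw [Finset.mem_filter] at hD
      obtain ⟨hD, hv'⟩ := hD
      push Not at hv'
      obtain ⟨e, he, hve⟩ := hv'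
      obtain ⟨w, rfl⟩ := hve
      refine ⟨⟨w, D.erase s(v, w)⟩, ?_, Finset.insert_erase he⟩
      obtain ⟨h1, h2, h3⟩ := mem_configsOn.1 hD
      exact Finset.mem_sigma.2 ⟨mem_nbrs.2 ⟨h3 _ he _ (by simp), h1 _ he⟩,
        erase_mem_configsOn hD he⟩
    · rintro ⟨w, D⟩ h
      obtain ⟨hw, hD⟩ := Finset.mem_sigma.1 h
      obtain ⟨h1, h2⟩ := insert_mem_configsOn hv hw hD
      dsimp only at *
      rw [Finset.card_insert_of_notMem h2]
      congr 1
      rw [mem_nbrs] at hw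
      rw [Finset.card_erase_of_mem (Finset.mem_erase.2 ⟨hw.2.ne', hw.1⟩),
        Finset.card_erase_of_mem hv]
      omega

/-- The partition function is invariant under graph embeddings. -/
theorem partitionOn_map {W : Type*} [Fintype W] [DecidableEq W] {H : SimpleGraph W}
    (φ : H ↪g G) (T : Finset W) (x : R) :
    partitionOn G (T.map φ.toEmbedding) x = partitionOn H T x := by
  induction hn : T.card using Nat.strong_induction_on generalizing T with
  | _ n ih =>
  rcases T.eq_empty_or_nonempty with rfl | ⟨v, hv⟩
  · simp [partitionOn_empty]
  · have hlt : (T.erase v).card < n := hn ▸ Finset.card_erase_lt_of_mem hv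
    have he : ∀ (T : Finset W) (v : W), (T.map φ.toEmbedding).erase (φ v) =
        (T.erase v).map φ.toEmbedding := fun T v => (Finset.map_erase φ.toEmbedding T v).symm
    have hnb : nbrs G (T.map φ.toEmbedding) (φ v) = (nbrs H T v).map φ.toEmbedding := by
      ext w
      simp only [mem_nbrs, Finset.mem_map]
      constructor
      · rintro ⟨⟨w, hw, rfl⟩, h⟩
        exact ⟨w, ⟨hw, φ.map_adj_iff.1 h⟩, rfl⟩
      · rintro ⟨w, ⟨hw, h⟩, rfl⟩
        exact ⟨⟨w, hw, rfl⟩, φ.map_adj_iff.2 h⟩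
    rw [partitionOn_rec (v := φ v) (Finset.mem_map_of_mem _ hv), partitionOn_rec hv, he, hnb,
      Finset.sum_map, ih _ hlt _ rfl]
    congr 1
    refine Finset.sum_congr rfl fun w _ => ?_
    rw [← ih _ (lt_of_le_of_lt (Finset.card_erase_le) hlt) _ rfl]
    exact congrArg (partitionOn G · x) (he _ _)

/-- Differentiating a monomial marks one of its monomers. The induction differentiates the recursion
at `v` and compares with the recursion, again at `v`, of each `Z(S \ u)`. A general field serves
both real and complex activities. -/
theorem hasDerivAt_partitionOn {𝕜 : Type*} [NontriviallyNormedField 𝕜] (G : SimpleGraph V)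
    (S : Finset V) (x : 𝕜) :
    HasDerivAt (partitionOn G S) (∑ v ∈ S, partitionOn G (S.erase v) x) x := by
  induction hn : S.card using Nat.strong_induction_on generalizing S with
  | _ n ih =>
  rcases S.eq_empty_or_nonempty with rfl | ⟨v, hv⟩
  · have : partitionOn G (∅ : Finset V) = fun _ : 𝕜 => 1 := funext fun y => partitionOn_empty y
    rw [this]
    simpa using hasDerivAt_const x (1 : 𝕜)
  · have hlt : (S.erase v).card < n := hn ▸ Finset.card_erase_lt_of_mem hv
    have h1 := ih _ hlt (S.erase v) rfl
    have h2 : ∀ w ∈ nbrs G S v, HasDerivAt (partitionOn G ((S.erase v).erase w))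
        (∑ u ∈ (S.erase v).erase w, partitionOn G (((S.erase v).erase w).erase u) x) x :=
      fun w _ => ih _ (lt_of_le_of_lt (Finset.card_erase_le (a := w)) hlt) _ rfl
    have h3 := ((hasDerivAt_id' x).fun_mul h1).fun_add (HasDerivAt.fun_sum h2)
    have hfun : partitionOn G S = fun y : 𝕜 => y * partitionOn G (S.erase v) y +
        ∑ w ∈ nbrs G S v, partitionOn G ((S.erase v).erase w) y :=
      funext fun y => partitionOn_rec hv y
    rw [hfun]
    refine h3.congr_deriv ?_
    rw [← Finset.add_sum_erase S _ hv, one_mul, add_assoc]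
    congr 1
    have h4 : ∀ u ∈ S.erase v, partitionOn G (S.erase u) x =
        x * partitionOn G ((S.erase v).erase u) x +
          ∑ w ∈ nbrs G (S.erase u) v, partitionOn G (((S.erase u).erase v).erase w) x := by
      intro u hu
      rw [partitionOn_rec (Finset.mem_erase.2 ⟨(Finset.ne_of_mem_erase hu).symm, hv⟩) x,
        Finset.erase_right_comm]
    rw [Finset.sum_congr rfl h4, Finset.sum_add_distrib, Finset.mul_sum]
    congr 1
    -- Both sides sum over pairs of a neighbour `w` of `v` and a further vertex `u`, in opposite
    -- orders.
    · rw [Finset.sum_sigma', Finset.sum_sigma']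
      refine Finset.sum_bij' (fun p _ => ⟨p.2, p.1⟩) (fun p _ => ⟨p.2, p.1⟩) ?_ ?_ ?_ ?_ ?_
      · rintro ⟨w, u⟩ h
        simp only [Finset.mem_sigma, mem_nbrs, Finset.mem_erase] at h ⊢
        tauto
      · rintro ⟨w, u⟩ h
        simp only [Finset.mem_sigma, mem_nbrs, Finset.mem_erase] at h ⊢
        have := h.2.2.ne'
        tauto
      · intros; rfl
      · intros; rfl
      · rintro ⟨w, u⟩ h
        dsimp only
        congr 1
        ext a
        simp only [Finset.mem_erase]
        tauto

end Recursion

/-- The difference of the two fractions is `(x b - x a) / ((x + a) (x + b))`, with denominator at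
least `x ^ 2`. This is the damping factor of one generation. -/
theorem abs_mul_inv_add_sub_le {x a b c : ℝ} (hx : 0 < x) (ha : 0 ≤ a) (hb : 0 ≤ b)
    (h : |x * a - x * b| ≤ c) :
    |x * (x + a)⁻¹ - x * (x + b)⁻¹| ≤ c * (x ^ 2)⁻¹ := by
  have h1 : 0 < x + a := by positivity
  have h2 : 0 < x + b := by positivity
  have hid : x * (x + a)⁻¹ - x * (x + b)⁻¹ = -(x * a - x * b) * ((x + a)⁻¹ * (x + b)⁻¹) := by
    field_simp
    ring
  rw [hid, abs_mul, abs_neg, abs_of_nonneg (by positivity : 0 ≤ (x + a)⁻¹ * (x + b)⁻¹)]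
  refine mul_le_mul h ?_ (by positivity) ((abs_nonneg _).trans h)
  rw [sq, mul_inv]
  exact mul_le_mul (inv_anti₀ hx (by linarith)) (inv_anti₀ hx (by linarith)) (by positivity)
    (by positivity)

/-! ### Monomer probabilities and their decay of correlation. -/

section Ratio

variable {V : Type*} [Fintype V] [DecidableEq V]

/-- The ratio `Z(S \ v) / Z(S)`; times `x` it is the probability that `v` is a monomer. -/
noncomputable def ratio {𝕜 : Type*} [Field 𝕜] (G : SimpleGraph V) (S : Finset V) (v : V) (x : 𝕜) :
    𝕜 :=
  partitionOn G (S.erase v) x / partitionOn G S x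

variable {G : SimpleGraph V} {S : Finset V} {v : V}

/-- Divide the Heilmann-Lieb recursion by `Z(S \ v)`. The ratios on the right live on a smaller set,
so estimates propagate by induction. -/
theorem ratio_rec {𝕜 : Type*} [Field 𝕜] (hv : v ∈ S) {x : 𝕜}
    (h : partitionOn G (S.erase v) x ≠ 0) :
    ratio G S v x = (x + ∑ w ∈ nbrs G S v, ratio G (S.erase v) w x)⁻¹ := by
  rw [ratio, ← inv_div, partitionOn_rec hv]
  simp only [ratio]
  rw [← Finset.sum_div, add_div, mul_div_cancel_right₀ _ h]

theorem ratio_map {𝕜 : Type*} [Field 𝕜] {W : Type*} [Fintype W] [DecidableEq W]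
    {H : SimpleGraph W} (φ : H ↪g G) (T : Finset W) (w : W) (x : 𝕜) :
    ratio G (T.map φ.toEmbedding) (φ w) x = ratio H T w x := by
  rw [ratio, ratio, partitionOn_map, ← partitionOn_map φ (T.erase w), Finset.map_erase]
  rfl

theorem partitionOn_pos (G : SimpleGraph V) (S : Finset V) {x : ℝ} (hx : 0 < x) :
    0 < partitionOn G S x :=
  Finset.sum_pos (fun D _ => pow_pos hx _) ⟨∅, mem_configsOn.2 (by simp)⟩

theorem ratio_pos (G : SimpleGraph V) (S : Finset V) (v : V) {x : ℝ} (hx : 0 < x) :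
    0 < ratio G S v x :=
  div_pos (partitionOn_pos G _ hx) (partitionOn_pos G _ hx)

theorem ratio_rec_of_pos (hv : v ∈ S) {x : ℝ} (hx : 0 < x) :
    ratio G S v x = (x + ∑ w ∈ nbrs G S v, ratio G (S.erase v) w x)⁻¹ :=
  ratio_rec hv (partitionOn_pos G _ hx).ne'

theorem sum_ratio_nonneg (G : SimpleGraph V) (S T : Finset V) {x : ℝ} (hx : 0 < x) :
    0 ≤ ∑ w ∈ T, ratio G S w x :=
  Finset.sum_nonneg fun w _ => (ratio_pos G S w hx).le

theorem ratio_le_inv (hv : v ∈ S) {x : ℝ} (hx : 0 < x) : ratio G S v x ≤ x⁻¹ := by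
  rw [ratio_rec_of_pos hv hx]
  exact inv_anti₀ hx (le_add_of_nonneg_right (sum_ratio_nonneg _ _ _ hx))

theorem mul_ratio_le_one (hv : v ∈ S) {x : ℝ} (hx : 0 < x) : x * ratio G S v x ≤ 1 := by
  have := mul_le_mul_of_nonneg_left (ratio_le_inv (G := G) hv hx) hx.le
  rwa [mul_inv_cancel₀ hx.ne'] at this

theorem sum_ratio_erase_le (G : SimpleGraph V) (S : Finset V) (v : V) {x : ℝ} (hx : 0 < x) :
    ∑ w ∈ nbrs G S v, ratio G (S.erase v) w x ≤ (nbrs G S v).card * x⁻¹ := by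
  rw [← nsmul_eq_mul]
  refine Finset.sum_le_card_nsmul _ _ _ fun w hw => ?_
  rw [← nbrs_erase_self] at hw
  exact ratio_le_inv (mem_nbrs.1 hw).1 hx

theorem le_ratio (hv : v ∈ S) {x : ℝ} (hx : 0 < x) :
    (x + (nbrs G S v).card * x⁻¹)⁻¹ ≤ ratio G S v x := by
  rw [ratio_rec_of_pos hv hx]
  exact inv_anti₀ (add_pos_of_pos_of_nonneg hx (sum_ratio_nonneg _ _ _ hx))
    (add_le_add_right (sum_ratio_erase_le G S v hx) x)

/-- The probability that a dimer covers `v` is `Q` times the sum of the neighbouring ratios, all of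
these being at most `x⁻¹`. The decay in `x` later normalises the pressure at infinity and dominates
its integral. -/
theorem one_sub_mul_ratio_le (hv : v ∈ S) {x : ℝ} (hx : 0 < x) :
    1 - x * ratio G S v x ≤ (nbrs G S v).card * (x ^ 2)⁻¹ := by
  have h1 := sum_ratio_nonneg G (S.erase v) (nbrs G S v) hx
  have h2 := sum_ratio_erase_le G S v hx
  have h3 : ratio G S v x * (x + ∑ w ∈ nbrs G S v, ratio G (S.erase v) w x) = 1 := by
    rw [ratio_rec_of_pos hv hx]
    exact inv_mul_cancel₀ (by positivity)
  calc 1 - x * ratio G S v x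
      = ratio G S v x * ∑ w ∈ nbrs G S v, ratio G (S.erase v) w x := by linarith
    _ ≤ x⁻¹ * ((nbrs G S v).card * x⁻¹) :=
        mul_le_mul (ratio_le_inv hv hx) h2 h1 (by positivity)
    _ = _ := by rw [sq, mul_inv]; ring

/-- The number of self-avoiding walks with `r` steps from `v` that stay in `S` after `v`. -/
noncomputable def pathCount (G : SimpleGraph V) : ℕ → Finset V → V → ℕ
  | 0, _, _ => 1
  | r + 1, S, v => ∑ w ∈ nbrs G S v, pathCount G r (S.erase v) w

theorem pathCount_map {W : Type*} [Fintype W] [DecidableEq W]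
    {H : SimpleGraph W} (φ : H ↪g G) (r : ℕ) (T : Finset W) (w : W) :
    pathCount G r (T.map φ.toEmbedding) (φ w) = pathCount H r T w := by
  induction r generalizing T w with
  | zero => rfl
  | succ r ih =>
    have hnb : nbrs G (T.map φ.toEmbedding) (φ w) = (nbrs H T w).map φ.toEmbedding := by
      ext u
      simp only [mem_nbrs, Finset.mem_map]
      constructor
      · rintro ⟨⟨u, hu, rfl⟩, h⟩
        exact ⟨u, ⟨hu, φ.map_adj_iff.1 h⟩, rfl⟩
      · rintro ⟨u, ⟨hu, h⟩, rfl⟩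
        exact ⟨⟨u, hu, rfl⟩, φ.map_adj_iff.2 h⟩
    rw [pathCount, pathCount, hnb, Finset.sum_map]
    refine Finset.sum_congr rfl fun u _ => ?_
    rw [← ih, Finset.map_erase]
    rfl

/-- Ratios for two vertex sets that agree near `v` are close to each other. -/
theorem abs_ratio_sub_ratio_le {x : ℝ} (hx : 0 < x) (r : ℕ) {S T : Finset V} {v : V}
    (hTS : T ⊆ S) (hv : v ∈ T) (hr : ∀ u ∈ S, G.edist v u ≤ r → u ∈ T) :
    |x * ratio G S v x - x * ratio G T v x| ≤ (x ^ 2)⁻¹ ^ r * pathCount G r T v := by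
  induction r generalizing S T v with
  | zero =>
    have h1 := mul_ratio_le_one (G := G) (hTS hv) hx
    have h2 := mul_ratio_le_one (G := G) hv hx
    have h3 := mul_pos hx (ratio_pos G S v hx)
    have h4 := mul_pos hx (ratio_pos G T v hx)
    simp only [pow_zero, pathCount, Nat.cast_one, mul_one]
    rw [abs_le]
    constructor <;> linarith
  | succ r ih =>
    have hnb : nbrs G S v = nbrs G T v := by
      ext w
      simp only [mem_nbrs]
      refine ⟨fun h => ⟨hr w h.1 ?_, h.2⟩, fun h => ⟨hTS h.1, h.2⟩⟩
      rw [SimpleGraph.edist_eq_one_iff_adj.2 h.2]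
      simp
    -- From a neighbour `w` the two sets still agree up to distance `r`, by the triangle inequality.
    have hstep : ∀ w ∈ nbrs G T v,
        |x * ratio G (S.erase v) w x - x * ratio G (T.erase v) w x| ≤
          (x ^ 2)⁻¹ ^ r * pathCount G r (T.erase v) w := by
      intro w hw
      have hw' := mem_nbrs.1 hw
      refine ih (Finset.erase_subset_erase v hTS) (Finset.mem_erase.2 ⟨hw'.2.ne', hw'.1⟩)
        fun u hu hd => ?_
      rw [Finset.mem_erase] at hu ⊢
      refine ⟨hu.1, hr u hu.2 ?_⟩
      calc G.edist v u ≤ G.edist v w + G.edist w u := SimpleGraph.edist_triangle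
        _ ≤ 1 + r := add_le_add (SimpleGraph.edist_eq_one_iff_adj.2 hw'.2).le hd
        _ = ((r + 1 : ℕ) : ℕ∞) := by push_cast; ring
    set a := ∑ w ∈ nbrs G T v, ratio G (S.erase v) w x with ha
    set b := ∑ w ∈ nbrs G T v, ratio G (T.erase v) w x with hb
    have ha0 : 0 ≤ a := sum_ratio_nonneg _ _ _ hx
    have hb0 : 0 ≤ b := sum_ratio_nonneg _ _ _ hx
    have hS : ratio G S v x = (x + a)⁻¹ := by rw [ratio_rec_of_pos (hTS hv) hx, hnb]
    have hT : ratio G T v x = (x + b)⁻¹ := ratio_rec_of_pos hv hx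
    have hab : |x * a - x * b| ≤ (x ^ 2)⁻¹ ^ r * pathCount G (r + 1) T v := by
      rw [ha, hb, Finset.mul_sum, Finset.mul_sum, ← Finset.sum_sub_distrib, pathCount,
        Nat.cast_sum, Finset.mul_sum]
      exact (Finset.abs_sum_le_sum_abs _ _).trans (Finset.sum_le_sum hstep)
    rw [hS, hT, pow_succ, mul_right_comm]
    exact abs_mul_inv_add_sub_le hx ha0 hb0 hab

end Ratio

/-! ### Bounds for the derivative of a monomer probability. -/

section RatioDeriv

variable {V : Type*} [Fintype V] [DecidableEq V] {G : SimpleGraph V} {S : Finset V} {v : V}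

theorem differentiableAt_ratio (G : SimpleGraph V) (S : Finset V) (v : V) {x : ℝ} (hx : 0 < x) :
    DifferentiableAt ℝ (ratio G S v) x :=
  (hasDerivAt_partitionOn G _ x).differentiableAt.fun_div
    (hasDerivAt_partitionOn G _ x).differentiableAt (partitionOn_pos G S hx).ne'

theorem deriv_ratio (hv : v ∈ S) {x : ℝ} (hx : 0 < x) :
    deriv (ratio G S v) x =
      -(ratio G S v x) ^ 2 * (1 + ∑ w ∈ nbrs G S v, deriv (ratio G (S.erase v) w) x) := by
  have hev : ratio G S v =ᶠ[nhds x]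
      fun y => (y + ∑ w ∈ nbrs G S v, ratio G (S.erase v) w y)⁻¹ := by
    filter_upwards [lt_mem_nhds hx] with y hy using ratio_rec_of_pos hv hy
  have h1 : HasDerivAt (fun y => y + ∑ w ∈ nbrs G S v, ratio G (S.erase v) w y)
      (1 + ∑ w ∈ nbrs G S v, deriv (ratio G (S.erase v) w) x) x :=
    (hasDerivAt_id' x).fun_add
      (HasDerivAt.fun_sum fun w _ => (differentiableAt_ratio G _ w hx).hasDerivAt)
  have h0 : x + ∑ w ∈ nbrs G S v, ratio G (S.erase v) w x ≠ 0 :=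
    (add_pos_of_pos_of_nonneg hx (sum_ratio_nonneg _ _ _ hx)).ne'
  rw [hev.deriv_eq, (h1.fun_inv h0).deriv, ratio_rec_of_pos hv hx, inv_pow]
  field_simp

/-- The bounds `Q + x Q' ≥ 0` and `Q - x Q' ≥ 2 x Q²` for `Q = Z(S \ v) / Z(S)`. -/
theorem ratio_deriv_bounds (hv : v ∈ S) {x : ℝ} (hx : 0 < x) :
    0 ≤ ratio G S v x + x * deriv (ratio G S v) x ∧
      2 * x * ratio G S v x ^ 2 ≤ ratio G S v x - x * deriv (ratio G S v) x := by
  induction hn : S.card using Nat.strong_induction_on generalizing S v with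
  | _ n ih =>
  have ih' : ∀ w ∈ nbrs G S v, _ := fun w hw =>
    ih _ (hn ▸ Finset.card_erase_lt_of_mem hv) (S := S.erase v) (v := w)
      (mem_nbrs.1 (nbrs_erase_self (G := G) (S := S) ▸ hw)).1 rfl
  have h0 : ratio G S v x * (x + ∑ w ∈ nbrs G S v, ratio G (S.erase v) w x) = 1 := by
    rw [ratio_rec_of_pos hv hx]
    exact inv_mul_cancel₀ (add_pos_of_pos_of_nonneg hx (sum_ratio_nonneg _ _ _ hx)).ne'
  -- The two bounds must be proved together: `hA`, from the first bound at the neighbours, yields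
  -- the second at `v`, and `hB` yields the first.
  have hA : 0 ≤ ∑ w ∈ nbrs G S v,
      (ratio G (S.erase v) w x + x * deriv (ratio G (S.erase v) w) x) :=
    Finset.sum_nonneg fun w hw => (ih' w hw).1
  have hB : 0 ≤ ∑ w ∈ nbrs G S v,
      (ratio G (S.erase v) w x - x * deriv (ratio G (S.erase v) w) x) :=
    Finset.sum_nonneg fun w hw => le_trans (by positivity) (ih' w hw).2
  rw [Finset.sum_add_distrib, ← Finset.mul_sum] at hA
  rw [Finset.sum_sub_distrib, ← Finset.mul_sum] at hB
  rw [deriv_ratio hv hx]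
  set q := ratio G S v x
  set a := ∑ w ∈ nbrs G S v, ratio G (S.erase v) w x
  set b := ∑ w ∈ nbrs G S v, deriv (ratio G (S.erase v) w) x
  have e1 : q + x * (-q ^ 2 * (1 + b)) = q ^ 2 * (a - x * b) := by linear_combination -q * h0
  have e2 : q - x * (-q ^ 2 * (1 + b)) = 2 * x * q ^ 2 + q ^ 2 * (a + x * b) := by
    linear_combination -q * h0
  rw [e1, e2]
  exact ⟨by positivity, le_add_of_nonneg_right (by positivity)⟩

/-- Here the gain `2 x Q²` of the second bound is kept at each neighbour, which makes the derivative
strictly positive once `v` has a neighbour. -/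
theorem le_deriv_mul_ratio (hv : v ∈ S) {x : ℝ} (hx : 0 < x) :
    2 * x * ratio G S v x ^ 2 * ∑ w ∈ nbrs G S v, ratio G (S.erase v) w x ^ 2 ≤
      ratio G S v x + x * deriv (ratio G S v) x := by
  have h0 : ratio G S v x * (x + ∑ w ∈ nbrs G S v, ratio G (S.erase v) w x) = 1 := by
    rw [ratio_rec_of_pos hv hx]
    exact inv_mul_cancel₀ (add_pos_of_pos_of_nonneg hx (sum_ratio_nonneg _ _ _ hx)).ne'
  have hB : ∑ w ∈ nbrs G S v, 2 * x * ratio G (S.erase v) w x ^ 2 ≤ ∑ w ∈ nbrs G S v,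
      (ratio G (S.erase v) w x - x * deriv (ratio G (S.erase v) w) x) :=
    Finset.sum_le_sum fun w hw =>
      (ratio_deriv_bounds (mem_nbrs.1 (nbrs_erase_self (G := G) (S := S) ▸ hw)).1 hx).2
  rw [Finset.sum_sub_distrib, ← Finset.mul_sum, ← Finset.mul_sum] at hB
  rw [deriv_ratio hv hx]
  set q := ratio G S v x
  set a := ∑ w ∈ nbrs G S v, ratio G (S.erase v) w x
  set b := ∑ w ∈ nbrs G S v, deriv (ratio G (S.erase v) w) x
  have e1 : q + x * (-q ^ 2 * (1 + b)) = q ^ 2 * (a - x * b) := by linear_combination -q * h0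
  rw [e1, mul_right_comm, mul_comm]
  exact mul_le_mul_of_nonneg_left hB (sq_nonneg q)

end RatioDeriv

/-! ### Zero-freeness and ratio bounds in the right half-plane. -/

section ComplexRatio

variable {V : Type*} [Fintype V] [DecidableEq V] {G : SimpleGraph V} {S : Finset V} {v : V}

/-- The partition function has no zero in the right half-plane, and the ratios have positive
real part there. -/
theorem partitionOn_ne_zero_and_re_ratio_pos (G : SimpleGraph V) (S : Finset V) {z : ℂ}
    (hz : 0 < z.re) :
    partitionOn G S z ≠ 0 ∧ ∀ v ∈ S, 0 < (ratio G S v z).re ∧ z.re ≤ ((ratio G S v z)⁻¹).re := by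
  induction hn : S.card using Nat.strong_induction_on generalizing S with
  | _ n ih =>
  have key : ∀ v ∈ S, partitionOn G (S.erase v) z ≠ 0 ∧
      z.re ≤ (z + ∑ w ∈ nbrs G S v, ratio G (S.erase v) w z).re := by
    intro v hv
    obtain ⟨h1, h2⟩ := ih _ (hn ▸ Finset.card_erase_lt_of_mem hv) (S.erase v) rfl
    refine ⟨h1, ?_⟩
    rw [Complex.add_re, Complex.re_sum]
    refine le_add_of_nonneg_right (Finset.sum_nonneg fun w hw => (h2 w ?_).1.le)
    exact (mem_nbrs.1 (nbrs_erase_self (G := G) (S := S) ▸ hw)).1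
  refine ⟨?_, fun v hv => ?_⟩
  · rcases S.eq_empty_or_nonempty with rfl | ⟨v, hv⟩
    · simp [partitionOn_empty]
    · obtain ⟨h1, h2⟩ := key v hv
      have h3 := ratio_rec (G := G) hv h1
      intro h0
      -- Division by zero makes the ratio `0`, so the recursion would force a number of positive
      -- real part to vanish.
      rw [ratio, h0, div_zero, eq_comm, inv_eq_zero] at h3
      rw [h3, Complex.zero_re] at h2
      linarith
  · obtain ⟨h1, h2⟩ := key v hv
    rw [ratio_rec hv h1, inv_inv]
    refine ⟨?_, h2⟩
    rw [Complex.inv_re]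
    have h3 := hz.trans_le h2
    refine div_pos h3 (Complex.normSq_pos.2 fun h => ?_)
    rw [h, Complex.zero_re] at h3
    exact lt_irrefl _ h3

/-- Since `Re z ≤ Re (1 / Q) ≤ |1 / Q|`. Independence of the graph is what Vitali's theorem
requires. -/
theorem norm_ratio_le (hv : v ∈ S) {z : ℂ} (hz : 0 < z.re) : ‖ratio G S v z‖ ≤ z.re⁻¹ := by
  have h := ((partitionOn_ne_zero_and_re_ratio_pos G S hz).2 v hv).2.trans
    (Complex.re_le_norm _)
  rw [norm_inv] at h
  rw [← inv_inv ‖ratio G S v z‖]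
  exact inv_anti₀ hz h

theorem differentiableAt_ratio_complex (G : SimpleGraph V) (S : Finset V) (v : V) {z : ℂ}
    (hz : 0 < z.re) : DifferentiableAt ℂ (ratio G S v) z :=
  (hasDerivAt_partitionOn G _ z).differentiableAt.fun_div
    (hasDerivAt_partitionOn G _ z).differentiableAt (partitionOn_ne_zero_and_re_ratio_pos G S hz).1

theorem ratio_ofReal (G : SimpleGraph V) (S : Finset V) (v : V) (x : ℝ) :
    ratio G S v (x : ℂ) = (ratio G S v x : ℝ) := by
  have h : ∀ T : Finset V, partitionOn G T (x : ℂ) = (partitionOn G T x : ℝ) :=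
    fun T => map_partitionOn Complex.ofRealHom x
  rw [ratio, ratio, h, h, Complex.ofReal_div]

end ComplexRatio

/-! ### Vitali's theorem on a disc, through Taylor coefficients. -/

section Vitali

open Filter Topology

theorem summable_mul_pow_of_le {b : ℕ → ℂ} {C R t : ℝ} (hR : 0 < R) (ht : 0 ≤ t) (htR : t < R)
    (hb : ∀ k, ‖b k‖ ≤ C * R⁻¹ ^ k) : Summable fun k => ‖b k‖ * t ^ k := by
  have h1 : t / R < 1 := (div_lt_one hR).2 htR
  refine Summable.of_nonneg_of_le (fun k => by positivity)
    (fun k => mul_le_mul_of_nonneg_right (hb k) (pow_nonneg ht k)) ?_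
  have : (fun k => C * R⁻¹ ^ k * t ^ k) = fun k => C * (t / R) ^ k := by
    ext k
    rw [div_eq_inv_mul, mul_pow, mul_assoc]
  rw [this]
  exact (summable_geometric_of_lt_one (by positivity) h1).mul_left C

theorem summable_mul_ofReal_pow_of_le {b : ℕ → ℂ} {C R t : ℝ} (hR : 0 < R) (ht : 0 ≤ t)
    (htR : t < R) (hb : ∀ k, ‖b k‖ ≤ C * R⁻¹ ^ k) : Summable fun k => b k * (t : ℂ) ^ k := by
  refine Summable.of_norm ((summable_mul_pow_of_le hR ht htR hb).congr fun k => ?_)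
  rw [norm_mul, norm_pow, Complex.norm_real, Real.norm_of_nonneg ht]

theorem norm_tsum_mul_ofReal_pow_le {b : ℕ → ℂ} {C R t : ℝ} (hR : 0 < R) (ht : 0 ≤ t)
    (htR : t ≤ R / 2) (hb : ∀ k, ‖b k‖ ≤ C * R⁻¹ ^ k) :
    ‖∑' k, b k * (t : ℂ) ^ k‖ ≤ C * 2 := by
  refine tsum_of_norm_bounded (hasSum_geometric_two.mul_left C) fun k => ?_
  rw [norm_mul, norm_pow, Complex.norm_real, Real.norm_of_nonneg ht]
  have hC : 0 ≤ C := by simpa using (norm_nonneg _).trans (hb 0)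
  calc ‖b k‖ * t ^ k ≤ C * R⁻¹ ^ k * (R / 2) ^ k :=
        mul_le_mul (hb k) (pow_le_pow_left₀ ht htR k) (by positivity) (by positivity)
    _ = C * (1 / 2) ^ k := by
        rw [mul_assoc, ← mul_pow]
        congr 2
        field_simp

variable {ι : Type*} {l : Filter ι}

/-- The sum is the head plus `t` times a uniformly bounded tail, so small `t` forces the head to
`0`; subtracting it and dividing by `t` treats the tail. Iteration reaches every coefficient. -/
theorem tendsto_head_tail {b : ι → ℕ → ℂ} {C R δ : ℝ} (hR : 0 < R) (hδ : 0 < δ)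
    (hδR : δ ≤ R / 2) (hb : ∀ i k, ‖b i k‖ ≤ C * R⁻¹ ^ k)
    (h : ∀ t : ℝ, 0 < t → t < δ → Tendsto (fun i => ∑' k, b i k * (t : ℂ) ^ k) l (𝓝 0)) :
    Tendsto (fun i => b i 0) l (𝓝 0) ∧
      ∀ t : ℝ, 0 < t → t < δ → Tendsto (fun i => ∑' k, b i (k + 1) * (t : ℂ) ^ k) l (𝓝 0) := by
  have hb' : ∀ i k, ‖b i (k + 1)‖ ≤ C * R⁻¹ * R⁻¹ ^ k := fun i k => by
    rw [mul_assoc, ← pow_succ']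
    exact hb i (k + 1)
  have hsplit : ∀ i (t : ℝ), 0 < t → t < δ → ∑' k, b i k * (t : ℂ) ^ k =
      b i 0 + t * ∑' k, b i (k + 1) * (t : ℂ) ^ k := by
    intro i t ht htδ
    rw [(summable_mul_ofReal_pow_of_le hR ht.le (by linarith) (hb i)).tsum_eq_zero_add,
      ← tsum_mul_left, pow_zero, mul_one]
    congr 1
    exact tsum_congr fun k => by ring
  have hhead : Tendsto (fun i => b i 0) l (𝓝 0) := by
    rw [Metric.tendsto_nhds]
    intro ε hε
    set M := |C * R⁻¹ * 2| + 1
    have hM : 0 < M := by positivity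
    set t := min (δ / 2) (ε / 2 / M)
    have ht : 0 < t := by positivity
    have htδ : t < δ := (min_le_left _ _).trans_lt (by linarith)
    filter_upwards [Metric.tendsto_nhds.1 (h t ht htδ) (ε / 2) (by positivity)] with i hi
    rw [dist_zero_right] at hi ⊢
    have h1 := norm_tsum_mul_ofReal_pow_le hR ht.le (by linarith) (hb' i)
    have h2 : b i 0 = (∑' k, b i k * (t : ℂ) ^ k) - t * ∑' k, b i (k + 1) * (t : ℂ) ^ k := by
      rw [hsplit i t ht htδ]
      ring
    have h3 : ‖(t : ℂ) * ∑' k, b i (k + 1) * (t : ℂ) ^ k‖ ≤ ε / 2 := by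
      rw [norm_mul, Complex.norm_real, Real.norm_of_nonneg ht.le]
      calc t * ‖∑' k, b i (k + 1) * (t : ℂ) ^ k‖ ≤ (ε / 2 / M) * M :=
            mul_le_mul (min_le_right _ _)
              (h1.trans ((le_abs_self _).trans (le_add_of_nonneg_right zero_le_one)))
              (norm_nonneg _) (by positivity)
        _ = ε / 2 := div_mul_cancel₀ _ hM.ne'
    rw [h2]
    exact (norm_sub_le _ _).trans_lt (by linarith)
  refine ⟨hhead, fun t ht htδ => ?_⟩
  have h1 := ((h t ht htδ).sub hhead).const_mul ((t : ℂ)⁻¹)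
  rw [sub_zero, mul_zero] at h1
  refine h1.congr fun i => ?_
  rw [hsplit i t ht htδ, add_sub_cancel_left,
    inv_mul_cancel_left₀ (Complex.ofReal_ne_zero.2 ht.ne')]

theorem tendsto_coeff {b : ι → ℕ → ℂ} {C R δ : ℝ} (hR : 0 < R) (hδ : 0 < δ)
    (hδR : δ ≤ R / 2) (hb : ∀ i k, ‖b i k‖ ≤ C * R⁻¹ ^ k)
    (h : ∀ t : ℝ, 0 < t → t < δ → Tendsto (fun i => ∑' k, b i k * (t : ℂ) ^ k) l (𝓝 0))
    (k : ℕ) : Tendsto (fun i => b i k) l (𝓝 0) := by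
  induction k generalizing b C with
  | zero => exact (tendsto_head_tail hR hδ hδR hb h).1
  | succ k ih =>
    refine ih (b := fun i k => b i (k + 1)) (C := C * R⁻¹) (fun i k => ?_)
      (tendsto_head_tail hR hδ hδR hb h).2
    rw [mul_assoc, ← pow_succ']
    exact hb i (k + 1)

/-- Vitali's theorem on a disc: uniformly bounded holomorphic functions that tend to `0` on a
segment ending at the center tend to `0` uniformly on smaller discs. -/
theorem tendstoUniformlyOn_zero_of_bounded {h : ι → ℂ → ℂ} {c : ℂ} {C R r δ : ℝ} (hr : 0 < r)
    (hrR : r < R) (hδ : 0 < δ) (hd : ∀ i, DifferentiableOn ℂ (h i) (Metric.ball c R))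
    (hC : ∀ i, ∀ z ∈ Metric.ball c R, ‖h i z‖ ≤ C)
    (ht : ∀ t : ℝ, 0 < t → t < δ → Tendsto (fun i => h i (c + t)) l (𝓝 0)) :
    TendstoUniformlyOn h (fun _ => 0) l (Metric.closedBall c r) := by
  obtain ⟨R', hrR', hR'R⟩ := exists_between hrR
  have hR' : 0 < R' := hr.trans hrR'
  set b : ι → ℕ → ℂ := fun i k => (cauchyPowerSeries (h i) c R').coeff k with hbdef
  have hsum : ∀ i (w : ℂ), ‖w‖ < R' → HasSum (fun k => b i k * w ^ k) (h i (c + w)) := by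
    intro i w hw
    have hps := DifferentiableOn.hasFPowerSeriesOnBall (R := .mk R' hR'.le) (c := c) (f := h i)
      ((hd i).mono (Metric.closedBall_subset_ball hR'R)) hR'
    have := hps.hasSum (y := w) (by
      rw [Metric.mem_eball, edist_zero_right, enorm_eq_nnnorm]
      exact ENNReal.coe_lt_coe.2 hw)
    refine HasSum.congr_fun this fun k => ?_
    rw [FormalMultilinearSeries.apply_eq_pow_smul_coeff, smul_eq_mul, mul_comm]
    rfl
  have hb : ∀ i k, ‖b i k‖ ≤ C * R'⁻¹ ^ k := by
    intro i k
    rw [hbdef]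
    dsimp only
    rw [← FormalMultilinearSeries.norm_apply_eq_norm_coef]
    refine (norm_cauchyPowerSeries_le (h i) c R' k).trans ?_
    rw [abs_of_pos hR']
    refine mul_le_mul_of_nonneg_right ?_ (by positivity)
    have h1 : ‖∫ θ : ℝ in 0..2 * Real.pi, ‖h i (circleMap c R' θ)‖‖ ≤ C * |2 * Real.pi - 0| := by
      refine intervalIntegral.norm_integral_le_of_norm_le_const fun θ _ => ?_
      rw [norm_norm]
      refine hC i _ (Metric.closedBall_subset_ball hR'R ?_)
      exact circleMap_mem_closedBall c hR'.le θ
    rw [sub_zero, abs_of_pos Real.two_pi_pos] at h1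
    rw [inv_mul_le_iff₀ Real.two_pi_pos, mul_comm _ C]
    exact (le_abs_self _).trans h1
  have hcoeff : ∀ k, Tendsto (fun i => b i k) l (𝓝 0) := by
    refine tendsto_coeff (δ := min δ (R' / 2)) hR' (by positivity) (min_le_right _ _) hb ?_
    intro t ht0 htδ
    refine (ht t ht0 (htδ.trans_le (min_le_left _ _))).congr fun i => ?_
    refine ((hsum i t ?_).tsum_eq).symm
    rw [Complex.norm_real, Real.norm_of_nonneg ht0.le]
    linarith [htδ.trans_le (min_le_right δ (R' / 2))]
  -- Dominated convergence over `k`, with majorant `C (r / R')^k`, turns convergence of coefficients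
  -- into uniform convergence.
  have hlim : Tendsto (fun i => ∑' k, ‖b i k‖ * r ^ k) l (𝓝 (∑' _ : ℕ, 0)) := by
    refine tendsto_tsum_of_dominated_convergence (bound := fun k => C * R'⁻¹ ^ k * r ^ k) ?_ ?_ ?_
    · have : (fun k => C * R'⁻¹ ^ k * r ^ k) = fun k => C * (r / R') ^ k := by
        ext k
        rw [div_eq_inv_mul, mul_pow, mul_assoc]
      rw [this]
      exact (summable_geometric_of_lt_one (by positivity) ((div_lt_one hR').2 hrR')).mul_left C
    · intro k
      simpa using (hcoeff k).norm.mul_const (r ^ k)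
    · refine Eventually.of_forall fun i k => ?_
      rw [Real.norm_of_nonneg (by positivity)]
      exact mul_le_mul_of_nonneg_right (hb i k) (by positivity)
  rw [tsum_zero] at hlim
  rw [Metric.tendstoUniformlyOn_iff]
  intro ε hε
  filter_upwards [hlim.eventually (gt_mem_nhds hε)] with i hi z hz
  rw [dist_zero_left]
  have hz' : ‖z - c‖ ≤ r := by rwa [← dist_eq_norm]
  have h1 := hsum i (z - c) (hz'.trans_lt hrR')
  rw [add_sub_cancel] at h1
  rw [← h1.tsum_eq]
  refine (tsum_of_norm_bounded (summable_mul_pow_of_le hR' hr.le hrR' (hb i)).hasSum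
    fun k => ?_).trans_lt hi
  rw [norm_mul, norm_pow]
  exact mul_le_mul_of_nonneg_left (pow_le_pow_left₀ (norm_nonneg _) hz' k) (norm_nonneg _)

end Vitali

/-! ### Isomorphism classes of finite rooted graphs. -/

section RootedClasses

theorem RootedIso.refl {V : Type*} (G : SimpleGraph V) (o : V) : RootedIso G o G o :=
  ⟨SimpleGraph.Iso.refl, rfl⟩

theorem RootedIso.symm {V W : Type*} {G : SimpleGraph V} {o : V} {H : SimpleGraph W} {o' : W}
    (h : RootedIso G o H o') : RootedIso H o' G o := by
  obtain ⟨φ, rfl⟩ := h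
  exact ⟨φ.symm, φ.symm_apply_apply o⟩

theorem RootedIso.trans {U V W : Type*} {G : SimpleGraph U} {o : U} {H : SimpleGraph V} {o' : V}
    {K : SimpleGraph W} {o'' : W} (h : RootedIso G o H o') (h' : RootedIso H o' K o'') :
    RootedIso G o K o'' := by
  obtain ⟨φ, rfl⟩ := h
  obtain ⟨ψ, rfl⟩ := h'
  exact ⟨φ.trans ψ, rfl⟩

/-- Finite rooted graphs with vertices labelled by `0, …, m - 1`. -/
abbrev FinRooted : Type := (m : ℕ) × (SimpleGraph (Fin m) × Fin m)

/-- Rooted isomorphism of finite rooted graphs. -/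
def rootedSetoid : Setoid FinRooted where
  r A B := RootedIso A.2.1 A.2.2 B.2.1 B.2.2
  iseqv := ⟨fun _ => RootedIso.refl _ _, RootedIso.symm, RootedIso.trans⟩

/-- Isomorphism classes of finite rooted graphs. -/
def RootedClass : Type := Quotient rootedSetoid

/-- Countability lets the almost sure limits for the individual classes hold simultaneously, and
turns integrals into sums over classes. -/
instance : Countable RootedClass :=
  inferInstanceAs (Countable (Quotient rootedSetoid))

namespace RootedClass

/-- A representative of a class of finite rooted graphs. -/
noncomputable def rep (q : RootedClass) : FinRooted := Quotient.out q

/-- The graph of the representative. -/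
noncomputable def graph (q : RootedClass) : SimpleGraph (Fin q.rep.1) := q.rep.2.1

/-- The root of the representative. -/
noncomputable def root (q : RootedClass) : Fin q.rep.1 := q.rep.2.2

end RootedClass

/-- The isomorphism class of a finite rooted graph. -/
noncomputable def classOf {W : Type*} [Finite W] (G : SimpleGraph W) (o : W) : RootedClass :=
  Quotient.mk rootedSetoid
    ⟨Nat.card W, G.map (Finite.equivFin W).toEmbedding, Finite.equivFin W o⟩

theorem rootedIso_classOf {W : Type*} [Finite W] (G : SimpleGraph W) (o : W) :
    RootedIso G o (classOf G o).graph (classOf G o).root := by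
  have h1 : RootedIso G o (G.map (Finite.equivFin W).toEmbedding) (Finite.equivFin W o) :=
    ⟨SimpleGraph.Iso.map (Finite.equivFin W) G, rfl⟩
  exact h1.trans (RootedIso.symm (Quotient.mk_out (s := rootedSetoid)
    ⟨Nat.card W, G.map (Finite.equivFin W).toEmbedding, Finite.equivFin W o⟩))

theorem classOf_eq_iff {W : Type*} [Finite W] {G : SimpleGraph W} {o : W} {q : RootedClass} :
    classOf G o = q ↔ RootedIso G o q.graph q.root := by
  constructor
  · rintro rfl
    exact rootedIso_classOf G o
  · intro h
    have h1 : RootedIso (classOf G o).graph (classOf G o).root q.graph q.root :=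
      (rootedIso_classOf G o).symm.trans h
    have h2 : Quotient.mk rootedSetoid (classOf G o).rep = Quotient.mk rootedSetoid q.rep :=
      Quotient.sound h1
    exact (Quotient.out_eq (classOf G o)).symm.trans (h2.trans (Quotient.out_eq q))

theorem RootedIso.ratio_eq {V W : Type*} [Fintype V] [DecidableEq V] [Fintype W] [DecidableEq W]
    {G : SimpleGraph V} {o : V} {H : SimpleGraph W} {o' : W} (h : RootedIso G o H o') (x : ℝ) :
    ratio G Finset.univ o x = ratio H Finset.univ o' x := by
  obtain ⟨φ, rfl⟩ := h
  rw [← ratio_map φ.toEmbedding]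
  congr 1
  ext w
  simp

theorem RootedIso.pathCount_eq {V W : Type*} [Fintype V] [DecidableEq V] [Fintype W]
    [DecidableEq W] {G : SimpleGraph V} {o : V} {H : SimpleGraph W} {o' : W}
    (h : RootedIso G o H o') (r : ℕ) :
    pathCount G r Finset.univ o = pathCount H r Finset.univ o' := by
  obtain ⟨φ, rfl⟩ := h
  rw [← pathCount_map φ.toEmbedding]
  congr 1
  ext w
  simp

/-- The probability that the root of a graph in the class is a monomer. -/
noncomputable def RootedClass.density (q : RootedClass) (x : ℝ) : ℝ :=
  x * ratio q.graph Finset.univ q.root x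

/-- The number of self-avoiding walks with `r` steps from the root. -/
noncomputable def RootedClass.paths (q : RootedClass) (r : ℕ) : ℕ :=
  pathCount q.graph r Finset.univ q.root

theorem RootedClass.density_nonneg (q : RootedClass) {x : ℝ} (hx : 0 < x) : 0 ≤ q.density x :=
  (mul_pos hx (ratio_pos _ _ _ hx)).le

theorem RootedClass.density_le_one (q : RootedClass) {x : ℝ} (hx : 0 < x) : q.density x ≤ 1 :=
  mul_ratio_le_one (Finset.mem_univ _) hx

variable {V : Type*} [Fintype V] [DecidableEq V]

/-- The class of the ball of radius `r` about `v`. -/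
noncomputable def ballClass (G : SimpleGraph V) (r : ℕ) (v : V) : RootedClass :=
  classOf (ball G v r) (ballCenter G v r)

/-- The ball is an induced subgraph containing every vertex within distance `r`, so decay of
correlation applies. The minimum with `1` keeps the error a bounded function of the class, whose
averages converge. -/
theorem abs_ratio_sub_density_le (G : SimpleGraph V) (r : ℕ) (v : V) {x : ℝ} (hx : 0 < x) :
    |x * ratio G Finset.univ v x - (ballClass G r v).density x| ≤
      min 1 ((x ^ 2)⁻¹ ^ r * (ballClass G r v).paths r) := by
  classical
  have hiso := rootedIso_classOf (ball G v r) (ballCenter G v r)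
  let φ : ball G v r ↪g G := SimpleGraph.Embedding.induce _
  set T : Finset V := Finset.univ.map φ.toEmbedding with hT
  have hmem : ∀ u, u ∈ T ↔ u ∈ ballVertices G v r := by
    intro u
    simp [hT, φ]
  have h1 : (ballClass G r v).density x = x * ratio G T v x := by
    rw [RootedClass.density, ballClass, ← hiso.ratio_eq x, ← ratio_map φ]
    rfl
  have h2 : (ballClass G r v).paths r = pathCount G r T v := by
    rw [RootedClass.paths, ballClass, ← hiso.pathCount_eq r, ← pathCount_map φ]
    rfl
  have hvT : v ∈ T := (hmem v).2 (center_mem_ballVertices G v r)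
  refine le_min ?_ ?_
  · have h3 := mul_ratio_le_one (G := G) (Finset.mem_univ v) hx
    have h4 := mul_pos hx (ratio_pos G Finset.univ v hx)
    have h5 := (ballClass G r v).density_nonneg hx
    have h6 := (ballClass G r v).density_le_one hx
    rw [abs_le]
    constructor <;> linarith
  · rw [h1, h2]
    exact abs_ratio_sub_ratio_le hx r (Finset.subset_univ T) hvT fun u _ hu => (hmem u).2 hu

end RootedClasses

/-! ### From class frequencies to averages of bounded functions. -/

section Averages

open Filter Topology

/-- The average of a function over the vertices. -/
noncomputable def average (N : ℕ) (f : Fin N → ℝ) : ℝ := (∑ v, f v) / N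

theorem average_mono {N : ℕ} {f g : Fin N → ℝ} (h : ∀ v, f v ≤ g v) : average N f ≤ average N g :=
  div_le_div_of_nonneg_right (Finset.sum_le_sum fun v _ => h v) (Nat.cast_nonneg N)

theorem average_sub {N : ℕ} (f g : Fin N → ℝ) :
    average N (fun v => f v - g v) = average N f - average N g := by
  rw [average, average, average, Finset.sum_sub_distrib, sub_div]

theorem abs_average_le {N : ℕ} (f : Fin N → ℝ) : |average N f| ≤ average N fun v => |f v| := by
  rw [average, average, abs_div, Nat.abs_cast]
  exact div_le_div_of_nonneg_right (Finset.abs_sum_le_sum_abs _ _) (Nat.cast_nonneg N)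

theorem average_const {N : ℕ} (hN : N ≠ 0) (c : ℝ) : average N (fun _ => c) = c := by
  rw [average, Finset.sum_const, Finset.card_univ, Fintype.card_fin, nsmul_eq_mul,
    mul_div_cancel_left₀ _ (Nat.cast_ne_zero.2 hN)]

theorem measurable_comp_of_fibers {Q Ω R : Type*} [Countable Q] [MeasurableSpace Ω]
    [MeasurableSpace R] {C : Ω → Q} (hC : ∀ q, MeasurableSet {K | C K = q}) (f : Q → R) :
    Measurable fun K => f (C K) := by
  let : MeasurableSpace Q := ⊤
  have hCm : Measurable C := measurable_to_countable' hC
  exact (measurable_from_top (f := f)).comp hCm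

variable {Q : Type*} [DecidableEq Q]

theorem sum_frequency_mul_le_average {N : ℕ} (c : Fin N → Q) {f : Q → ℝ} (hf : ∀ q, 0 ≤ f q)
    (F : Finset Q) :
    ∑ q ∈ F, ((Finset.univ.filter fun v => c v = q).card : ℝ) / N * f q ≤
      average N fun v => f (c v) := by
  have h : ∀ q ∈ F, ((Finset.univ.filter fun v => c v = q).card : ℝ) / N * f q =
      (∑ v ∈ (Finset.univ.filter fun v => c v ∈ F).filter (fun v => c v = q), f (c v)) / N := by
    intro q hq
    have : (Finset.univ.filter fun v => c v ∈ F).filter (fun v => c v = q) =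
        Finset.univ.filter fun v => c v = q := by
      ext v
      simp only [Finset.mem_filter, Finset.mem_univ, true_and]
      exact ⟨fun h => h.2, fun h => ⟨h ▸ hq, h⟩⟩
    rw [this, Finset.sum_congr rfl (g := fun _ => f q)
      (fun v hv => by rw [(Finset.mem_filter.1 hv).2]), Finset.sum_const, nsmul_eq_mul,
      div_mul_eq_mul_div]
  rw [Finset.sum_congr rfl h, ← Finset.sum_div,
    Finset.sum_fiberwise_of_maps_to (fun v hv => (Finset.mem_filter.1 hv).2)]
  exact div_le_div_of_nonneg_right (Finset.sum_le_sum_of_subset_of_nonneg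
    (Finset.filter_subset _ _) fun v _ _ => hf _) (Nat.cast_nonneg N)

variable [Countable Q] {Ω : Type*} [MeasurableSpace Ω] {ν : Measure Ω} [IsProbabilityMeasure ν]
  {N : ℕ → ℕ} {c : ∀ n, Fin (N n) → Q} {C : Ω → Q}

/-- Finitely many classes carry the integral up to `η / 2`, their frequencies converge, and all
other vertices contribute nonnegatively. Classes outside the range of `C`, about which nothing is
assumed, are simply dropped. -/
theorem eventually_integral_sub_le_average (hC : ∀ q, MeasurableSet {K | C K = q})
    (hfreq : ∀ q ∈ Set.range C, Tendsto
      (fun n => ((Finset.univ.filter fun v => c n v = q).card : ℝ) / N n) atTop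
      (𝓝 (ν.real {K | C K = q})))
    {f : Q → ℝ} {M : ℝ} (hf : ∀ q, 0 ≤ f q) (hfM : ∀ q, f q ≤ M) {η : ℝ} (hη : 0 < η) :
    ∀ᶠ n in atTop, ∫ K, f (C K) ∂ν - η ≤ average (N n) fun v => f (c n v) := by
  let : MeasurableSpace Q := ⊤
  have : MeasurableSingletonClass Q := ⟨fun _ => trivial⟩
  have hCm : Measurable C := measurable_to_countable' hC
  have := Measure.isProbabilityMeasure_map (μ := ν) hCm.aemeasurable
  have hint : Integrable f (ν.map C) :=
    Integrable.of_bound (measurable_from_top.aestronglyMeasurable) M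
      (Eventually.of_forall fun q => by rw [Real.norm_of_nonneg (hf q)]; exact hfM q)
  have h1 : ∫ K, f (C K) ∂ν = ∑' q, ν.real {K | C K = q} * f q := by
    rw [← integral_map hCm.aemeasurable (measurable_from_top.aestronglyMeasurable),
      integral_countable hint]
    refine tsum_congr fun q => ?_
    rw [map_measureReal_apply hCm (measurableSet_singleton q), smul_eq_mul]
    rfl
  obtain ⟨F, hF⟩ : ∃ F : Finset Q, ∑' q, ν.real {K | C K = q} * f q - η / 2 ≤
      ∑ q ∈ F, ν.real {K | C K = q} * f q := by
    by_cases hs : Summable fun q => ν.real {K | C K = q} * f q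
    · obtain ⟨F, hF⟩ := ((tendsto_order.1 hs.hasSum).1 _ (sub_lt_self _ (half_pos hη))).exists
      exact ⟨F, hF.le⟩
    -- A non-summable series has sum `0` by convention.
    · refine ⟨∅, ?_⟩
      rw [tsum_eq_zero_of_not_summable hs]
      simpa using (half_pos hη).le
  classical
  set F' := F.filter (fun q => q ∈ Set.range C)
  have hF' : ∑ q ∈ F, ν.real {K | C K = q} * f q = ∑ q ∈ F', ν.real {K | C K = q} * f q := by
    symm
    refine Finset.sum_subset (Finset.filter_subset _ _) fun q hq hq' => ?_
    have : {K | C K = q} = ∅ := by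
      ext K
      simp only [Set.mem_ofPred_eq, Set.mem_empty_iff_false, iff_false]
      exact fun h => hq' (Finset.mem_filter.2 ⟨hq, K, h⟩)
    rw [this, measureReal_empty, zero_mul]
  have hlim : Tendsto (fun n => ∑ q ∈ F',
      ((Finset.univ.filter fun v => c n v = q).card : ℝ) / N n * f q) atTop
      (𝓝 (∑ q ∈ F', ν.real {K | C K = q} * f q)) :=
    tendsto_finsetSum _ fun q hq => (hfreq q (Finset.mem_filter.1 hq).2).mul_const _
  filter_upwards [(tendsto_order.1 hlim).1 _ (sub_lt_self _ (half_pos hη))] with n hn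
  have := sum_frequency_mul_le_average (c n) hf F'
  rw [h1]
  linarith

/-- Without vertices the average of the constant `1` would be `0 / 0 = 0`, below the lower bound `1
/ 2`. -/
theorem eventually_ne_zero_of_frequency (hC : ∀ q, MeasurableSet {K | C K = q})
    (hfreq : ∀ q ∈ Set.range C, Tendsto
      (fun n => ((Finset.univ.filter fun v => c n v = q).card : ℝ) / N n) atTop
      (𝓝 (ν.real {K | C K = q}))) : ∀ᶠ n in atTop, N n ≠ 0 := by
  filter_upwards [eventually_integral_sub_le_average hC hfreq (f := fun _ => 1) (M := 1)
    (fun _ => zero_le_one) (fun _ => le_rfl) (η := 1 / 2) (by norm_num)] with n hn h0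
  rw [average, h0, Nat.cast_zero, div_zero, integral_const, probReal_univ] at hn
  norm_num at hn

/-- If the frequencies of all classes converge to a probability distribution, so do the averages of
all bounded functions of the class. -/
theorem tendsto_average (hC : ∀ q, MeasurableSet {K | C K = q})
    (hfreq : ∀ q ∈ Set.range C, Tendsto
      (fun n => ((Finset.univ.filter fun v => c n v = q).card : ℝ) / N n) atTop
      (𝓝 (ν.real {K | C K = q})))
    {f : Q → ℝ} {M : ℝ} (hf : ∀ q, 0 ≤ f q) (hfM : ∀ q, f q ≤ M) :
    Tendsto (fun n => average (N n) fun v => f (c n v)) atTop (𝓝 (∫ K, f (C K) ∂ν)) := by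
  rw [Metric.tendsto_nhds]
  intro η hη
  have hint : Integrable (fun K => f (C K)) ν :=
    Integrable.of_bound (measurable_comp_of_fibers hC f).aestronglyMeasurable M
      (Eventually.of_forall fun K => by rw [Real.norm_of_nonneg (hf _)]; exact hfM _)
  -- The lower bound for `M - f` is the upper bound for `f`, because the limit has total mass one.
  filter_upwards [eventually_ne_zero_of_frequency hC hfreq,
    eventually_integral_sub_le_average hC hfreq hf hfM (half_pos hη),
    eventually_integral_sub_le_average hC hfreq (f := fun q => M - f q) (M := M)
      (fun q => sub_nonneg.2 (hfM q)) (fun q => sub_le_self _ (hf q)) (half_pos hη)] with n h0 h1 h2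
  rw [average_sub, average_const h0, integral_sub (integrable_const _) hint, integral_const,
    probReal_univ, one_smul] at h2
  rw [Real.dist_eq, abs_lt]
  constructor <;> linarith

end Averages

/-! ### Truncated trees and their self-avoiding walks. -/

section OffspringTree

variable {K : List ℕ → ℕ}

theorem isTreeVertex_concat {v : List ℕ} {i : ℕ} :
    IsTreeVertex K (v ++ [i]) ↔ IsTreeVertex K v ∧ i < K v := by
  constructor
  · intro h
    exact ⟨fun u j huj => h u j (huj.trans (List.prefix_append v [i])), h v i List.prefix_rfl⟩
  · rintro ⟨h1, h2⟩ u j huj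
    rcases List.prefix_concat_iff.1 huj with h | h
    · obtain ⟨rfl, h'⟩ := List.append_inj' h rfl
      rw [List.singleton_inj] at h'
      exact h' ▸ h2
    · exact h1 u j h

theorem IsTreeVertex.dropLast {v : List ℕ} (h : IsTreeVertex K v) : IsTreeVertex K v.dropLast :=
  fun u i hu => h u i (hu.trans (List.dropLast_prefix v))

/-- The words of length at most `r` in the tree. -/
def treeVertices (K : List ℕ → ℕ) (r : ℕ) : Set (List ℕ) := {v | v.length ≤ r ∧ IsTreeVertex K v}

theorem finite_treeVertices (K : List ℕ → ℕ) (r : ℕ) : (treeVertices K r).Finite := by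
  induction r with
  | zero =>
    refine (Set.finite_singleton []).subset fun v hv => ?_
    exact List.length_eq_zero_iff.1 (Nat.le_zero.1 hv.1)
  | succ r ih =>
    refine (ih.union (ih.biUnion fun u _ =>
      (Set.finite_Iio (K u)).image fun i => u ++ [i])).subset fun v hv => ?_
    rcases List.eq_nil_or_concat v with rfl | ⟨u, i, rfl⟩
    · exact Or.inl ⟨Nat.zero_le _, isTreeVertex_nil K⟩
    · rw [List.concat_eq_append] at hv ⊢
      obtain ⟨h1, h2⟩ := hv
      rw [isTreeVertex_concat] at h2
      rw [List.length_append, List.length_singleton] at h1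
      exact Or.inr (Set.mem_biUnion (x := u) ⟨by omega, h2.1⟩ ⟨i, h2.2, rfl⟩)

theorem length_le_add_length_walk {v w : {v : List ℕ // IsTreeVertex K v}}
    (p : (offspringTree K).Walk v w) : w.1.length ≤ v.1.length + p.length := by
  induction p with
  | nil => simp
  | cons h p ih =>
    rw [SimpleGraph.Walk.length_cons]
    rcases h with ⟨i, hi⟩ | ⟨i, hi⟩
    · rw [hi, List.length_append, List.length_singleton] at ih
      omega
    · rw [hi, List.length_append, List.length_singleton]
      omega

theorem edist_treeRoot_le (v : List ℕ) (hv : IsTreeVertex K v) :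
    (offspringTree K).edist (treeRoot K) ⟨v, hv⟩ ≤ v.length := by
  induction v using List.reverseRecOn with
  | nil => simp [treeRoot]
  | append_singleton v i ih =>
    have hv' := (isTreeVertex_concat.1 hv).1
    have hadj : (offspringTree K).Adj ⟨v, hv'⟩ ⟨v ++ [i], hv⟩ := Or.inl ⟨i, rfl⟩
    calc (offspringTree K).edist (treeRoot K) ⟨v ++ [i], hv⟩
        ≤ (offspringTree K).edist (treeRoot K) ⟨v, hv'⟩ +
          (offspringTree K).edist ⟨v, hv'⟩ ⟨v ++ [i], hv⟩ := SimpleGraph.edist_triangle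
      _ ≤ v.length + 1 := add_le_add (ih hv') (SimpleGraph.edist_eq_one_iff_adj.2 hadj).le
      _ = ((v ++ [i]).length : ℕ∞) := by simp

theorem mem_ballVertices_treeRoot {r : ℕ} {v : {v : List ℕ // IsTreeVertex K v}} :
    v ∈ ballVertices (offspringTree K) (treeRoot K) r ↔ v.1.length ≤ r := by
  constructor
  · intro h
    have h' : (offspringTree K).edist (treeRoot K) v ≤ r := h
    obtain ⟨p, hp⟩ := SimpleGraph.exists_walk_of_edist_ne_top
      (ne_top_of_le_ne_top (ENat.natCast_ne_top r) h')
    rw [← hp, Nat.cast_le] at h'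
    exact (length_le_add_length_walk p).trans ((Nat.zero_add _).le.trans h')
  · intro h
    exact (edist_treeRoot_le v.1 v.2).trans (Nat.cast_le.2 h)

/-- The vertices of the truncated tree. -/
abbrev TruncVertex (K : List ℕ → ℕ) (r : ℕ) : Type :=
  ballVertices (offspringTree K) (treeRoot K) r

/-- The truncated tree. -/
abbrev truncTree (K : List ℕ → ℕ) (r : ℕ) : SimpleGraph (TruncVertex K r) :=
  ball (offspringTree K) (treeRoot K) r

/-- The root of the truncated tree. -/
abbrev truncRoot (K : List ℕ → ℕ) (r : ℕ) : TruncVertex K r :=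
  ballCenter (offspringTree K) (treeRoot K) r

/-- The word of a vertex of the truncated tree. -/
def TruncVertex.word {r : ℕ} (v : TruncVertex K r) : List ℕ := v.1.1

theorem TruncVertex.word_injective {r : ℕ} :
    Function.Injective (TruncVertex.word : TruncVertex K r → List ℕ) :=
  fun _ _ h => Subtype.ext (Subtype.ext h)

theorem TruncVertex.word_mem {r : ℕ} (v : TruncVertex K r) : v.word ∈ treeVertices K r :=
  ⟨mem_ballVertices_treeRoot.1 v.2, v.1.2⟩

/-- The vertex of the truncated tree with a given word. -/
def TruncVertex.mk {r : ℕ} (v : List ℕ) (hv : v ∈ treeVertices K r) : TruncVertex K r :=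
  ⟨⟨v, hv.2⟩, mem_ballVertices_treeRoot.2 hv.1⟩

instance {r : ℕ} : Finite (TruncVertex K r) := by
  have := (finite_treeVertices K r).to_subtype
  refine Finite.of_injective (fun v : TruncVertex K r => (⟨v.word, v.word_mem⟩ : treeVertices K r))
    fun v w h => ?_
  have h' : v.word = w.word := congrArg (fun u : treeVertices K r => (u : List ℕ)) h
  exact TruncVertex.word_injective h'

theorem truncTree_adj {r : ℕ} {v w : TruncVertex K r} : (truncTree K r).Adj v w ↔
    (∃ i : ℕ, w.word = v.word ++ [i]) ∨ (∃ i : ℕ, v.word = w.word ++ [i]) :=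
  Iff.rfl

theorem exists_walk_truncTree {r : ℕ} (v : List ℕ) (hv : v ∈ treeVertices K r) :
    ∃ p : (truncTree K r).Walk (truncRoot K r) (TruncVertex.mk v hv), p.length = v.length := by
  induction v using List.reverseRecOn with
  | nil => exact ⟨SimpleGraph.Walk.nil, rfl⟩
  | append_singleton v i ih =>
    have hv' : v ∈ treeVertices K r := by
      refine ⟨?_, (isTreeVertex_concat.1 hv.2).1⟩
      have := hv.1
      rw [List.length_append] at this
      omega
    obtain ⟨p, hp⟩ := ih hv'
    have hadj : (truncTree K r).Adj (TruncVertex.mk v hv') (TruncVertex.mk (v ++ [i]) hv) :=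
      truncTree_adj.2 (Or.inl ⟨i, rfl⟩)
    refine ⟨p.concat hadj, ?_⟩
    rw [SimpleGraph.Walk.length_concat, hp, List.length_append, List.length_singleton]

theorem truncTree_dist_le {r : ℕ} (v : TruncVertex K r) :
    (truncTree K r).dist (truncRoot K r) v ≤ r := by
  obtain ⟨p, hp⟩ := exists_walk_truncTree v.word v.word_mem
  exact (SimpleGraph.dist_le p).trans (hp.le.trans v.word_mem.1)

theorem truncTree_connected (K : List ℕ → ℕ) (r : ℕ) : (truncTree K r).Connected := by
  have h : ∀ v, (truncTree K r).Reachable (truncRoot K r) v := fun v =>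
    (exists_walk_truncTree v.word v.word_mem).choose.reachable
  have : Nonempty (TruncVertex K r) := ⟨truncRoot K r⟩
  exact SimpleGraph.Connected.mk fun v w => (h v).symm.trans (h w)

/-- The parent of a vertex of the truncated tree. -/
def TruncVertex.parent {r : ℕ} (v : TruncVertex K r) : TruncVertex K r :=
  TruncVertex.mk v.word.dropLast
    ⟨(List.dropLast_prefix v.word).length_le.trans v.word_mem.1, v.word_mem.2.dropLast⟩

/-- Every edge joins a non-root vertex to its parent, so there are fewer edges than vertices, and
the graph is connected. -/
theorem truncTree_isTree (K : List ℕ → ℕ) (r : ℕ) : (truncTree K r).IsTree := by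
  rw [SimpleGraph.isTree_iff_connected_and_card]
  refine ⟨truncTree_connected K r,
    le_antisymm ?_ (truncTree_connected K r).card_vert_le_card_edgeSet_add_one⟩
  have hsub : (truncTree K r).edgeSet ⊆
      (fun v : TruncVertex K r => s(v.parent, v)) '' {v | v ≠ truncRoot K r} := by
    have key : ∀ (a b : TruncVertex K r) (i : ℕ), b.word = a.word ++ [i] →
        b ≠ truncRoot K r ∧ b.parent = a := by
      intro a b i h
      constructor
      · intro hb
        have h2 : b.word = [] := by rw [hb]; rfl
        rw [h2] at h
        simp at h
      · refine TruncVertex.word_injective ?_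
        change b.word.dropLast = a.word
        rw [h, List.dropLast_concat]
    intro e
    induction e using Sym2.ind with
    | _ a b =>
    intro he
    rcases truncTree_adj.1 he with ⟨i, hi⟩ | ⟨i, hi⟩
    · obtain ⟨h1, h2⟩ := key a b i hi
      exact ⟨b, h1, by dsimp only; rw [h2]⟩
    · obtain ⟨h1, h2⟩ := key b a i hi
      exact ⟨a, h1, by dsimp only; rw [h2, Sym2.eq_swap]⟩
  have h1 := (Set.ncard_le_ncard hsub (Set.toFinite _)).trans (Set.ncard_image_le (Set.toFinite _))
  have h2 : {v | v ≠ truncRoot K r}.ncard + ({truncRoot K r} : Set (TruncVertex K r)).ncard =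
      Nat.card (TruncVertex K r) := by
    rw [add_comm]
    exact Set.ncard_add_ncard_compl _ (Set.toFinite _) (Set.toFinite _)
  rw [Set.ncard_singleton] at h2
  have h3 : Nat.card (truncTree K r).edgeSet = (truncTree K r).edgeSet.ncard := rfl
  omega

/-- The number of descendants of `v` after `j` generations. -/
def descendants (K : List ℕ → ℕ) : ℕ → List ℕ → ℕ
  | 0, _ => 1
  | j + 1, v => ∑ i ∈ Finset.range (K v), descendants K j (v ++ [i])

/-- The hypothesis `hS` says that the parent of `v` is no longer available. A self-avoiding walk can
then only descend, and a step to a son removes that son's parent. -/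
theorem pathCount_truncTree_le [DecidableEq (TruncVertex K r)] (j : ℕ)
    (S : Finset (TruncVertex K r)) (v : TruncVertex K r)
    (hS : ∀ w ∈ S, ∀ i, v.word ≠ w.word ++ [i]) :
    pathCount (truncTree K r) j S v ≤ descendants K j v.word := by
  induction j generalizing S v with
  | zero => exact le_rfl
  | succ j ih =>
    have hstep : ∀ w ∈ nbrs (truncTree K r) S v,
        pathCount (truncTree K r) j (S.erase v) w ≤ descendants K j w.word := by
      intro w hw
      refine ih _ _ fun u hu i hui => ?_
      obtain ⟨huv, huS⟩ := Finset.mem_erase.1 hu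
      rw [mem_nbrs] at hw
      rcases truncTree_adj.1 hw.2 with ⟨k, hk⟩ | ⟨k, hk⟩
      · rw [hk] at hui
        exact huv (TruncVertex.word_injective (List.append_inj' hui rfl).1.symm)
      · exact hS w hw.1 k hk
    rw [pathCount, descendants]
    refine (Finset.sum_le_sum hstep).trans ?_
    have h1 : ∑ w ∈ nbrs (truncTree K r) S v, descendants K j w.word =
        ∑ x ∈ (nbrs (truncTree K r) S v).image TruncVertex.word, descendants K j x :=
      (Finset.sum_image fun a _ b _ h => TruncVertex.word_injective h).symm
    have h2 : ∑ i ∈ Finset.range (K v.word), descendants K j (v.word ++ [i]) =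
        ∑ x ∈ (Finset.range (K v.word)).image (fun i => v.word ++ [i]), descendants K j x :=
      (Finset.sum_image fun a _ b _ h => by simpa using h).symm
    rw [h1, h2]
    refine Finset.sum_le_sum_of_subset fun x hx => ?_
    obtain ⟨w, hw, rfl⟩ := Finset.mem_image.1 hx
    rw [mem_nbrs] at hw
    rcases truncTree_adj.1 hw.2 with ⟨k, hk⟩ | ⟨k, hk⟩
    · refine Finset.mem_image.2 ⟨k, Finset.mem_range.2 ?_, hk.symm⟩
      have := w.word_mem.2
      rw [hk] at this
      exact (isTreeVertex_concat.1 this).2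
    · exact absurd hk (hS w hw.1 k)

/-- The class of the truncated tree. -/
noncomputable def treeClass (r : ℕ) (K : List ℕ → ℕ) : RootedClass :=
  classOf (truncTree K r) (truncRoot K r)

theorem paths_treeClass_le (r : ℕ) (K : List ℕ → ℕ) :
    (treeClass r K).paths r ≤ descendants K r [] := by
  classical
  have := Fintype.ofFinite (TruncVertex K r)
  rw [RootedClass.paths, treeClass, ← (rootedIso_classOf (truncTree K r) (truncRoot K r)).pathCount_eq]
  refine pathCount_truncTree_le r Finset.univ (truncRoot K r) fun w _ i h => ?_
  have h2 : (truncRoot K r).word = [] := rfl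
  rw [h2] at h
  simp at h

/-- Adjacency is read off the words, so the finite vertex set determines the class. There are
countably many such sets, whence the measurability of the fibres of `treeClass`. -/
theorem treeClass_congr {r : ℕ} {K K' : List ℕ → ℕ} (h : treeVertices K r = treeVertices K' r) :
    treeClass r K = treeClass r K' := by
  rw [treeClass, classOf_eq_iff]
  refine RootedIso.trans ?_ (rootedIso_classOf (truncTree K' r) (truncRoot K' r))
  exact ⟨⟨⟨fun v => TruncVertex.mk v.word (h ▸ v.word_mem),
    fun v => TruncVertex.mk v.word (h.symm ▸ v.word_mem), fun _ => rfl, fun _ => rfl⟩, Iff.rfl⟩, rfl⟩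

theorem RootedIso.isTree_dist_le {V W : Type*} {G : SimpleGraph V} {o : V} {H : SimpleGraph W}
    {o' : W} (h : RootedIso G o H o') (hG : G.IsTree) {r : ℕ} (hr : ∀ v, G.dist o v ≤ r) :
    H.IsTree ∧ ∀ w, H.dist o' w ≤ r := by
  obtain ⟨φ, rfl⟩ := h
  refine ⟨φ.isTree_iff.1 hG, fun w => ?_⟩
  obtain ⟨v, rfl⟩ := φ.surjective w
  obtain ⟨p, hp⟩ := (hG.connected o v).exists_walk_length_eq_dist
  refine (SimpleGraph.dist_le (p.map φ.toHom)).trans ?_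
  rw [SimpleGraph.Walk.length_map, hp]
  exact hr v

theorem treeClass_isTree (r : ℕ) (K : List ℕ → ℕ) :
    (treeClass r K).graph.IsTree ∧
      ∀ w, (treeClass r K).graph.dist (treeClass r K).root w ≤ r :=
  (rootedIso_classOf (truncTree K r) (truncRoot K r)).isTree_dist_le (truncTree_isTree K r)
    truncTree_dist_le

theorem exists_adj_root_treeClass {r : ℕ} (hr : 1 ≤ r) {K : List ℕ → ℕ} (hK : 1 ≤ K []) :
    ∃ w, (treeClass r K).graph.Adj (treeClass r K).root w := by
  obtain ⟨φ, hφ⟩ := rootedIso_classOf (truncTree K r) (truncRoot K r)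
  have hmem : [0] ∈ treeVertices K r :=
    ⟨hr, isTreeVertex_concat (v := []).2 ⟨isTreeVertex_nil K, hK⟩⟩
  have hadj : (truncTree K r).Adj (truncRoot K r) (TruncVertex.mk [0] hmem) :=
    truncTree_adj.2 (Or.inl ⟨0, rfl⟩)
  refine ⟨φ (TruncVertex.mk [0] hmem), ?_⟩
  have := φ.map_adj_iff.2 hadj
  rw [hφ] at this
  exact this

end OffspringTree

/-! ### The Galton-Watson law and expected generation sizes. -/

section OffspringLaw

variable {P ρ : PMF ℕ}

/-- The law of the number of sons of `v`. -/
noncomputable def letterLaw (P ρ : PMF ℕ) (v : List ℕ) : Measure ℕ :=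
  (if v = [] then P else ρ).toMeasure

instance (v : List ℕ) : IsProbabilityMeasure (letterLaw P ρ v) := by
  unfold letterLaw
  infer_instance

theorem offspringLaw_eq : offspringLaw P ρ = Measure.infinitePi (letterLaw P ρ) := rfl

instance : IsProbabilityMeasure (offspringLaw P ρ) := by
  rw [offspringLaw_eq]
  infer_instance

theorem measurableSet_isTreeVertex (v : List ℕ) : MeasurableSet {K | IsTreeVertex K v} := by
  have : {K | IsTreeVertex K v} =
      ⋂ (u : List ℕ) (i : ℕ) (_ : u ++ [i] <+: v), {K : List ℕ → ℕ | i < K u} := by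
    ext K
    simp [IsTreeVertex]
  rw [this]
  refine MeasurableSet.iInter fun u => MeasurableSet.iInter fun i => MeasurableSet.iInter fun _ => ?_
  exact measurableSet_lt measurable_const (measurable_pi_apply u)

theorem measurableSet_treeVertices_eq (r : ℕ) (A : Set (List ℕ)) :
    MeasurableSet {K | treeVertices K r = A} := by
  have : {K | treeVertices K r = A} = ⋂ v : List ℕ, {K | v ∈ treeVertices K r ↔ v ∈ A} := by
    ext K
    simp [Set.ext_iff]
  rw [this]
  refine MeasurableSet.iInter fun v => ?_
  have h1 : MeasurableSet {K | v ∈ treeVertices K r} :=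
    (MeasurableSet.const _).inter (measurableSet_isTreeVertex v)
  by_cases hv : v ∈ A
  · simpa [hv] using h1
  · have h2 : {K | v ∈ treeVertices K r ↔ v ∈ A} = {K | v ∈ treeVertices K r}ᶜ := by
      ext K
      simp [hv]
    rw [h2]
    exact h1.compl

theorem measurableSet_treeClass_eq (r : ℕ) (q : RootedClass) :
    MeasurableSet {K | treeClass r K = q} := by
  have : {K | treeClass r K = q} = ⋃ A : Finset (List ℕ),
      ⋃ (_ : ∃ K, treeVertices K r = A ∧ treeClass r K = q), {K | treeVertices K r = A} := by
    ext K
    simp only [Set.mem_iUnion, Set.mem_ofPred_eq, exists_prop]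
    constructor
    · intro h
      exact ⟨(finite_treeVertices K r).toFinset, ⟨K, by simp, h⟩, by simp⟩
    · rintro ⟨A, ⟨K', h1, h2⟩, h3⟩
      rw [← h2]
      exact treeClass_congr (h3.trans h1.symm)
  rw [this]
  exact MeasurableSet.iUnion fun A => MeasurableSet.iUnion fun _ =>
    measurableSet_treeVertices_eq r A

theorem tsum_toMeasure_Ioi (P : PMF ℕ) : ∑' i : ℕ, P.toMeasure (Set.Ioi i) = mean P := by
  have h : ∀ i : ℕ, P.toMeasure (Set.Ioi i) = ∑' k, if i < k then P k else 0 := by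
    intro i
    rw [PMF.toMeasure_apply _ measurableSet_Ioi]
    refine tsum_congr fun k => ?_
    rw [Set.indicator_apply]
    rfl
  simp_rw [h]
  rw [ENNReal.tsum_comm, mean]
  refine tsum_congr fun k => ?_
  rw [tsum_eq_sum (s := Finset.range k) fun i hi => if_neg (by simpa using hi),
    Finset.sum_congr rfl fun i hi => if_pos (Finset.mem_range.1 hi), Finset.sum_const,
    Finset.card_range, nsmul_eq_mul]

/-- Unimodularity gives `mean P * mean ρ = ∑ k (k + 1) P_{k+1}`, at most the second moment of `P`.
-/
theorem mean_ne_top (hu : IsUnimodular P ρ) (h2 : secondMoment P < ⊤) (h0 : 0 < mean P) :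
    mean ρ ≠ ⊤ := by
  have h : mean P * mean ρ ≤ secondMoment P := by
    rw [mean.eq_def ρ, ← ENNReal.tsum_mul_left, secondMoment,
      tsum_eq_zero_add' (f := fun k : ℕ => (k : ℝ≥0∞) ^ 2 * P k) ENNReal.summable]
    refine le_add_left (ENNReal.tsum_le_tsum fun k => ?_)
    rw [mul_left_comm, hu.2 k, ← mul_assoc, sq]
    push_cast
    gcongr
    exact le_self_add
  intro h'
  rw [h', ENNReal.mul_top h0.ne'] at h
  exact absurd (h.trans_lt h2) (lt_irrefl _)

theorem descendants_succ (K : List ℕ → ℕ) (j : ℕ) (v : List ℕ) :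
    (descendants K (j + 1) v : ℝ≥0∞) = ∑' i : ℕ,
      {K : List ℕ → ℕ | i < K v}.indicator (fun K => (descendants K j (v ++ [i]) : ℝ≥0∞)) K := by
  rw [descendants, tsum_eq_sum (s := Finset.range (K v))
    fun i hi => Set.indicator_of_notMem (by simpa using hi) _, Nat.cast_sum]
  refine Finset.sum_congr rfl fun i hi => ?_
  rw [Set.indicator_of_mem (by simpa using hi)]

theorem measurableSet_lt_apply (v : List ℕ) (i : ℕ) :
    MeasurableSet {K : List ℕ → ℕ | i < K v} :=
  measurableSet_lt measurable_const (measurable_pi_apply v)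

theorem measurable_descendants (j : ℕ) (v : List ℕ) :
    Measurable fun K => (descendants K j v : ℝ≥0∞) := by
  induction j generalizing v with
  | zero =>
    simp only [descendants]
    exact measurable_const
  | succ j ih =>
    simp_rw [descendants_succ]
    exact Measurable.tsum fun i => (ih _).indicator (measurableSet_lt_apply v i)

/-- Integrating over cylinders on words shorter than `v` encodes independence: the event that the
son `v ++ [i]` exists only adds the coordinate `v`, and the result is a cylinder admissible for that
longer word. -/
theorem setLIntegral_descendants_succ (j : ℕ) (v : List ℕ) (s : Finset (List ℕ))
    (t : List ℕ → Set ℕ) (hs : ∀ u ∈ s, u.length < v.length) {m : ℝ≥0∞}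
    (ih : ∀ (i : ℕ) (s : Finset (List ℕ)) (t : List ℕ → Set ℕ),
      (∀ u ∈ s, u.length < (v ++ [i]).length) →
      ∫⁻ K in (s : Set (List ℕ)).pi t, descendants K j (v ++ [i]) ∂(offspringLaw P ρ) ≤
        offspringLaw P ρ ((s : Set (List ℕ)).pi t) * m) :
    ∫⁻ K in (s : Set (List ℕ)).pi t, descendants K (j + 1) v ∂(offspringLaw P ρ) ≤
      offspringLaw P ρ ((s : Set (List ℕ)).pi t) *
        ((∑' i : ℕ, letterLaw P ρ v (Set.Ioi i)) * m) := by
  classical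
  have hvs : v ∉ s := fun h => lt_irrefl _ (hs v h)
  simp_rw [descendants_succ]
  rw [lintegral_tsum fun i =>
      ((measurable_descendants j _).indicator (measurableSet_lt_apply v i)).aemeasurable,
    ← ENNReal.tsum_mul_right, ← ENNReal.tsum_mul_left]
  refine ENNReal.tsum_le_tsum fun i => ?_
  rw [lintegral_indicator (measurableSet_lt_apply v i),
    Measure.restrict_restrict (measurableSet_lt_apply v i)]
  have hset : {K : List ℕ → ℕ | i < K v} ∩ (s : Set (List ℕ)).pi t =
      ((insert v s : Finset (List ℕ)) : Set (List ℕ)).pi (Function.update t v (Set.Ioi i)) := by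
    rw [Finset.coe_insert, Set.insert_pi, Function.update_self]
    congr 1
    refine Set.pi_congr rfl fun u hu => ?_
    rw [Function.update_of_ne (fun h => hvs (by rw [← h]; exact hu))]
  have hmeas : offspringLaw P ρ
      (((insert v s : Finset (List ℕ)) : Set (List ℕ)).pi (Function.update t v (Set.Ioi i))) =
      letterLaw P ρ v (Set.Ioi i) * offspringLaw P ρ ((s : Set (List ℕ)).pi t) := by
    rw [offspringLaw_eq, Measure.infinitePi_pi _ fun _ _ => MeasurableSet.of_discrete,
      Measure.infinitePi_pi _ fun _ _ => MeasurableSet.of_discrete, Finset.prod_insert hvs, Function.update_self]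
    congr 1
    refine Finset.prod_congr rfl fun u hu => ?_
    rw [Function.update_of_ne (fun h => hvs (by rw [← h]; exact hu))]
  rw [hset]
  refine (ih i _ _ fun u hu => ?_).trans ?_
  · rw [List.length_append, List.length_singleton]
    rcases Finset.mem_insert.1 hu with rfl | hu
    · omega
    · have := hs u hu
      omega
  · rw [hmeas]
    exact le_of_eq (by ring)

theorem setLIntegral_descendants_le (j : ℕ) (v : List ℕ) (hv : v ≠ []) (s : Finset (List ℕ))
    (t : List ℕ → Set ℕ) (hs : ∀ u ∈ s, u.length < v.length) :
    ∫⁻ K in (s : Set (List ℕ)).pi t, descendants K j v ∂(offspringLaw P ρ) ≤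
      offspringLaw P ρ ((s : Set (List ℕ)).pi t) * mean ρ ^ j := by
  induction j generalizing v s t with
  | zero => simp [descendants]
  | succ j ih =>
    refine (setLIntegral_descendants_succ j v s t hs (m := mean ρ ^ j)
      fun i s t hs => ih _ (by simp) s t hs).trans (le_of_eq ?_)
    rw [letterLaw, if_neg hv, tsum_toMeasure_Ioi, pow_succ']

theorem lintegral_descendants_le (j : ℕ) :
    ∫⁻ K, descendants K (j + 1) [] ∂(offspringLaw P ρ) ≤ mean P * mean ρ ^ j := by
  have h := setLIntegral_descendants_succ (P := P) (ρ := ρ) j [] ∅ (fun _ => Set.univ) (by simp)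
    (m := mean ρ ^ j) fun i s t hs => setLIntegral_descendants_le j _ (by simp) s t hs
  rw [letterLaw, if_pos rfl, tsum_toMeasure_Ioi] at h
  simpa using h

theorem offspringLaw_root_pos (h0 : 0 < mean P) : 0 < offspringLaw P ρ {K | 1 ≤ K []} := by
  have h1 : {K : List ℕ → ℕ | 1 ≤ K []} =
      ((({[]} : Finset (List ℕ)) : Set (List ℕ)).pi fun _ => Set.Ioi 0) := by
    ext K
    simp [Nat.one_le_iff_ne_zero, Nat.pos_iff_ne_zero]
  rw [h1, offspringLaw_eq, Measure.infinitePi_pi _ fun _ _ => MeasurableSet.of_discrete, Finset.prod_singleton,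
    letterLaw, if_pos rfl, pos_iff_ne_zero]
  intro h
  refine h0.ne' ?_
  rw [← tsum_toMeasure_Ioi, ENNReal.tsum_eq_zero]
  intro i
  exact measure_mono_null (Set.Ioi_subset_Ioi (Nat.zero_le i)) h

/-- Some class of truncated trees in which the root is not isolated has positive probability. -/
theorem exists_treeClass_pos {r : ℕ} (hr : 1 ≤ r) (h0 : 0 < mean P) :
    ∃ K, (∃ w, (treeClass r K).graph.Adj (treeClass r K).root w) ∧
      0 < (offspringLaw P ρ).real {K' | treeClass r K' = treeClass r K} := by
  by_contra! hcon
  refine (offspringLaw_root_pos (ρ := ρ) h0).ne' ?_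
  -- If all these classes were null, so would be their countable union, which contains an event of
  -- positive probability.
  have hsub : {K : List ℕ → ℕ | 1 ≤ K []} ⊆ ⋃ q : RootedClass,
      ⋃ (_ : ∃ K, (∃ w, (treeClass r K).graph.Adj (treeClass r K).root w) ∧ treeClass r K = q),
        {K | treeClass r K = q} := by
    intro K hK
    simp only [Set.mem_iUnion, Set.mem_ofPred_eq, exists_prop]
    exact ⟨treeClass r K, ⟨K, exists_adj_root_treeClass hr hK, rfl⟩, rfl⟩
  refine measure_mono_null hsub (measure_iUnion_null fun q => measure_iUnion_null ?_)
  rintro ⟨K, hK, rfl⟩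
  exact (measureReal_eq_zero_iff).1 (le_antisymm (hcon K hK) measureReal_nonneg)

end OffspringLaw

/-! ### Density and pressure of a finite graph. -/

section FiniteGraphs

open Filter Topology

variable {N : ℕ} (G : SimpleGraph (Fin N))

theorem hasDerivAt_pressure {x : ℝ} (hx : 0 < x) :
    HasDerivAt (pressure G) (average N fun v => ratio G Finset.univ v x) x := by
  have h1 : pressure G = fun y => Real.log (partitionOn G Finset.univ y) / N := by
    ext y
    rw [pressure, partitionOn_univ, Fintype.card_fin]
  have h2 := ((hasDerivAt_partitionOn G Finset.univ x).log
    (partitionOn_pos G Finset.univ hx).ne').div_const (N : ℝ)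
  rw [h1]
  refine h2.congr_deriv ?_
  rw [average, Finset.sum_div]
  rfl

theorem monomerDensity_eq {x : ℝ} (hx : 0 < x) :
    monomerDensity G x = average N fun v => x * ratio G Finset.univ v x := by
  rw [monomerDensity, (hasDerivAt_pressure G hx).deriv, average, average, ← Finset.mul_sum,
    mul_div_assoc]

/-- The monomer density at complex activities. -/
noncomputable def complexDensity (z : ℂ) : ℂ := (∑ v, z * ratio G Finset.univ v z) / N

theorem complexDensity_ofReal {x : ℝ} (hx : 0 < x) :
    complexDensity G x = (monomerDensity G x : ℝ) := by
  rw [monomerDensity_eq G hx, complexDensity, average]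
  push_cast
  simp_rw [ratio_ofReal]

theorem norm_complexDensity_le {z : ℂ} (hz : 0 < z.re) : ‖complexDensity G z‖ ≤ ‖z‖ * z.re⁻¹ := by
  rw [complexDensity, norm_div, Complex.norm_natCast]
  refine div_le_of_le_mul₀ (Nat.cast_nonneg _) (by positivity) ?_
  refine (norm_sum_le_of_le _ (f := fun v => z * ratio G Finset.univ v z)
    (n := fun _ => ‖z‖ * z.re⁻¹) fun v hv => ?_).trans ?_
  · rw [norm_mul]
    exact mul_le_mul_of_nonneg_left (norm_ratio_le hv hz) (norm_nonneg _)
  · rw [Finset.sum_const, Finset.card_univ, Fintype.card_fin, nsmul_eq_mul, mul_comm]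

theorem differentiableAt_complexDensity {z : ℂ} (hz : 0 < z.re) :
    DifferentiableAt ℂ (complexDensity G) z :=
  (DifferentiableAt.fun_sum fun v _ =>
    differentiableAt_id.fun_mul (differentiableAt_ratio_complex G _ v hz)).div_const _

theorem hasDerivAt_monomerDensity {x : ℝ} (hx : 0 < x) :
    HasDerivAt (monomerDensity G) (average N fun v =>
      ratio G Finset.univ v x + x * deriv (ratio G Finset.univ v) x) x := by
  have h1 : HasDerivAt (fun y => average N fun v => y * ratio G Finset.univ v y)
      (average N fun v => ratio G Finset.univ v x + x * deriv (ratio G Finset.univ v) x) x := by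
    refine (HasDerivAt.fun_sum fun v _ => ?_).div_const _
    have := (hasDerivAt_id' x).fun_mul (differentiableAt_ratio G Finset.univ v hx).hasDerivAt
    rwa [one_mul] at this
  refine h1.congr_of_eventuallyEq ?_
  filter_upwards [lt_mem_nhds hx] with y hy using monomerDensity_eq G hy

theorem monomerDensity_le_one {x : ℝ} (hx : 0 < x) : monomerDensity G x ≤ 1 := by
  rw [monomerDensity_eq G hx, average]
  refine div_le_of_le_mul₀ (Nat.cast_nonneg _) zero_le_one ?_
  rw [one_mul]
  refine (Finset.sum_le_card_nsmul _ _ 1 fun v hv => mul_ratio_le_one hv hx).trans ?_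
  simp

theorem one_sub_monomerDensity_le (hN : N ≠ 0) {x : ℝ} (hx : 0 < x) :
    1 - monomerDensity G x ≤
      (average N fun v => ((nbrs G Finset.univ v).card : ℝ)) * (x ^ 2)⁻¹ := by
  rw [monomerDensity_eq G hx, ← average_const hN 1, ← average_sub]
  refine (average_mono fun v => one_sub_mul_ratio_le (Finset.mem_univ v) hx).trans ?_
  rw [average, average, ← Finset.sum_mul, div_mul_eq_mul_div]

/-- Removing one vertex divides the normalised partition function by `x Q`, up to inversion, and `x
Q` tends to `1`. -/
theorem tendsto_partitionOn_div_pow (S : Finset (Fin N)) :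
    Tendsto (fun x : ℝ => partitionOn G S x / x ^ S.card) atTop (𝓝 1) := by
  induction hn : S.card using Nat.strong_induction_on generalizing S with
  | _ n ih =>
  rcases S.eq_empty_or_nonempty with rfl | ⟨v, hv⟩
  · simp [← hn, partitionOn_empty]
  · have h1 := ih _ (hn ▸ Finset.card_erase_lt_of_mem hv) (S.erase v) rfl
    have h2 : Tendsto (fun x : ℝ => x * ratio G S v x) atTop (𝓝 1) := by
      have h3 : Tendsto (fun x : ℝ => 1 - ((nbrs G S v).card : ℝ) * (x ^ 2)⁻¹) atTop (𝓝 1) := by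
        have h4 : Tendsto (fun x : ℝ => (x ^ 2)⁻¹) atTop (𝓝 0) :=
          tendsto_inv_atTop_zero.comp (tendsto_pow_atTop two_ne_zero)
        simpa using (h4.const_mul ((nbrs G S v).card : ℝ)).const_sub 1
      refine tendsto_of_tendsto_of_tendsto_of_le_of_le' h3 tendsto_const_nhds ?_ ?_
      · filter_upwards [eventually_gt_atTop 0] with x hx
        linarith [one_sub_mul_ratio_le (G := G) hv hx]
      · filter_upwards [eventually_gt_atTop 0] with x hx using mul_ratio_le_one hv hx
    have h3 := h1.div h2 one_ne_zero
    rw [div_one] at h3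
    refine h3.congr' ?_
    filter_upwards [eventually_gt_atTop 0] with x hx
    have h4 := (partitionOn_pos G S hx).ne'
    have h5 := (partitionOn_pos G (S.erase v) hx).ne'
    rw [Pi.div_apply, ratio, ← hn, ← Finset.card_erase_add_one hv, pow_succ]
    field_simp

theorem tendsto_pressure_sub_log (hN : N ≠ 0) :
    Tendsto (fun x : ℝ => pressure G x - Real.log x) atTop (𝓝 0) := by
  have h1 := ((Real.continuousAt_log one_ne_zero).tendsto.comp
    (tendsto_partitionOn_div_pow G Finset.univ)).div_const (N : ℝ)
  rw [Real.log_one, zero_div] at h1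
  refine h1.congr' ?_
  filter_upwards [eventually_gt_atTop 0] with x hx
  have hN' : (N : ℝ) ≠ 0 := Nat.cast_ne_zero.2 hN
  rw [Function.comp_apply, Real.log_div (partitionOn_pos G _ hx).ne' (by positivity), Real.log_pow,
    pressure, ← partitionOn_univ, Finset.card_univ, Fintype.card_fin, sub_div,
    mul_div_cancel_left₀ _ hN']

/-- The pressure as an integral of the monomer density. -/
theorem pressure_eq_integral (hN : N ≠ 0) {x : ℝ} (hx : 0 < x) :
    IntegrableOn (fun t => (1 - monomerDensity G t) / t) (Set.Ioi x) ∧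
      pressure G x = Real.log x + ∫ t in Set.Ioi x, (1 - monomerDensity G t) / t := by
  have hderiv : ∀ t, 0 < t → HasDerivAt (fun t => pressure G t - Real.log t)
      (-((1 - monomerDensity G t) / t)) t := by
    intro t ht
    refine ((hasDerivAt_pressure G ht).sub (Real.hasDerivAt_log ht.ne')).congr_deriv ?_
    rw [monomerDensity, (hasDerivAt_pressure G ht).deriv]
    field_simp
    ring
  have hcont : ContinuousWithinAt (fun t => pressure G t - Real.log t) (Set.Ici x) x :=
    (hderiv x hx).continuousAt.continuousWithinAt
  -- The derivative has constant sign and its primitive a limit at infinity, so integrability is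
  -- automatic.
  have hint : IntegrableOn (fun t => -((1 - monomerDensity G t) / t)) (Set.Ioi x) := by
    refine integrableOn_Ioi_deriv_of_nonpos hcont (fun t ht => hderiv t (hx.trans ht)) ?_
      (tendsto_pressure_sub_log G hN)
    intro t ht
    have ht' : 0 < t := hx.trans ht
    exact neg_nonpos.2 (div_nonneg (sub_nonneg.2 (monomerDensity_le_one G ht')) ht'.le)
  have h := integral_Ioi_of_hasDerivAt_of_tendsto hcont (fun t ht => hderiv t (hx.trans ht)) hint
    (tendsto_pressure_sub_log G hN)
  rw [integral_neg] at h
  refine ⟨by simpa using hint.neg, by linarith⟩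

end FiniteGraphs

/-! ### Convergence of the density at every positive activity. -/

section GoodSequences

open Filter Topology

/-- Sequences of graphs that converge locally to the Galton-Watson tree and have bounded average
degree. -/
structure GoodSeq (P ρ : PMF ℕ) (g : ℕ → FinGraph) : Prop where
  freq : ∀ (r : ℕ), ∀ q ∈ Set.range (treeClass r), Tendsto (fun n =>
    (({v : Fin (g n).card | ballClass (g n).graph r v = q} : Set _).ncard : ℝ) / (g n).card) atTop
      (𝓝 ((offspringLaw P ρ).real {K | treeClass r K = q}))
  sparse : ∃ C : ℝ, ∀ᶠ n in atTop,
    (average (g n).card fun v => ((nbrs (g n).graph Finset.univ v).card : ℝ)) ≤ C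

variable {P ρ : PMF ℕ} {g g' : ℕ → FinGraph}

open Classical in
theorem GoodSeq.freq' (hg : GoodSeq P ρ g) (r : ℕ) : ∀ q ∈ Set.range (treeClass r),
    Tendsto (fun n => ((Finset.univ.filter fun v => ballClass (g n).graph r v = q).card : ℝ) /
      (g n).card) atTop (𝓝 ((offspringLaw P ρ).real {K | treeClass r K = q})) := by
  intro q hq
  refine (hg.freq r q hq).congr fun n => ?_
  rw [← Set.ncard_coe_finset]
  simp

theorem GoodSeq.eventually_card_ne_zero (hg : GoodSeq P ρ g) : ∀ᶠ n in atTop, (g n).card ≠ 0 := by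
  classical
  exact eventually_ne_zero_of_frequency (measurableSet_treeClass_eq 0) (hg.freq' 0)

theorem GoodSeq.tendsto_average (hg : GoodSeq P ρ g) (r : ℕ) {f : RootedClass → ℝ} {M : ℝ}
    (hf : ∀ q, 0 ≤ f q) (hfM : ∀ q, f q ≤ M) :
    Tendsto (fun n => average (g n).card fun v => f (ballClass (g n).graph r v)) atTop
      (𝓝 (∫ K, f (treeClass r K) ∂(offspringLaw P ρ))) := by
  classical
  exact MonomerDimer.tendsto_average (measurableSet_treeClass_eq r) (hg.freq' r) hf hfM

theorem integral_min_paths_le (hP : mean P ≠ ⊤) (hρ : mean ρ ≠ ⊤) {a : ℝ} (ha : 0 ≤ a) (j : ℕ) :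
    ∫ K, min 1 (a * ((treeClass (j + 1) K).paths (j + 1) : ℝ)) ∂(offspringLaw P ρ) ≤
      a * ((mean P).toReal * (mean ρ).toReal ^ j) := by
  have hmeas := measurable_comp_of_fibers (measurableSet_treeClass_eq (j + 1))
    fun q : RootedClass => min 1 (a * (q.paths (j + 1) : ℝ))
  rw [integral_eq_lintegral_of_nonneg_ae (Eventually.of_forall fun K => by positivity)
    hmeas.aestronglyMeasurable]
  have h1 : ∫⁻ K, ENNReal.ofReal (min 1 (a * ((treeClass (j + 1) K).paths (j + 1) : ℝ)))
      ∂(offspringLaw P ρ) ≤ ENNReal.ofReal a * (mean P * mean ρ ^ j) := by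
    refine le_trans (lintegral_mono (g := fun K => ENNReal.ofReal a *
      (descendants K (j + 1) [] : ℝ≥0∞)) fun K => ?_) ?_
    · refine (ENNReal.ofReal_le_ofReal (min_le_right _ _)).trans ?_
      rw [ENNReal.ofReal_mul ha, ENNReal.ofReal_natCast]
      exact mul_le_mul_right (Nat.cast_le.2 (paths_treeClass_le (j + 1) K)) _
    · rw [lintegral_const_mul _ (measurable_descendants _ _)]
      exact mul_le_mul_right (lintegral_descendants_le j) _
  refine (ENNReal.toReal_mono ?_ h1).trans (le_of_eq ?_)
  · exact ENNReal.mul_ne_top ENNReal.ofReal_ne_top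
      (ENNReal.mul_ne_top hP (ENNReal.pow_ne_top hρ))
  · rw [ENNReal.toReal_mul, ENNReal.toReal_mul, ENNReal.toReal_pow, ENNReal.toReal_ofReal ha]

/-- At large activities the monomer density of all good sequences is asymptotically given by the
monomer density at the root of a truncated tree. -/
theorem exists_approx_density (hP : mean P ≠ ⊤) (hρ : mean ρ ≠ ⊤) {x : ℝ} (hx : 0 < x)
    (hxρ : (mean ρ).toReal < x ^ 2) {η : ℝ} (hη : 0 < η) :
    ∃ L : ℝ, ∀ g, GoodSeq P ρ g → ∀ᶠ n in atTop, |monomerDensity (g n).graph x - L| < η := by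
  set m := (mean ρ).toReal
  have hm : 0 ≤ m := ENNReal.toReal_nonneg
  have hlim : Tendsto (fun j : ℕ => (x ^ 2)⁻¹ * (mean P).toReal * (m / x ^ 2) ^ j) atTop
      (𝓝 ((x ^ 2)⁻¹ * (mean P).toReal * 0)) :=
    (tendsto_pow_atTop_nhds_zero_of_lt_one (by positivity)
      ((div_lt_one (by positivity)).2 hxρ)).const_mul _
  rw [mul_zero] at hlim
  obtain ⟨j, hj⟩ := (hlim.eventually (gt_mem_nhds (half_pos hη))).exists
  -- The depth `j + 1` was fixed before `g`, so one number serves all good sequences.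
  refine ⟨∫ K, (treeClass (j + 1) K).density x ∂(offspringLaw P ρ), fun g hg => ?_⟩
  have h1 := hg.tendsto_average (j + 1) (f := fun q => q.density x) (M := 1)
    (fun q => q.density_nonneg hx) fun q => q.density_le_one hx
  have h2 := hg.tendsto_average (j + 1)
    (f := fun q => min 1 ((x ^ 2)⁻¹ ^ (j + 1) * (q.paths (j + 1) : ℝ))) (M := 1)
    (fun q => by positivity) fun q => min_le_left _ _
  have h3 := integral_min_paths_le (P := P) (ρ := ρ) hP hρ
    (a := (x ^ 2)⁻¹ ^ (j + 1)) (by positivity) j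
  have h4 : (x ^ 2)⁻¹ ^ (j + 1) * ((mean P).toReal * m ^ j) < η / 2 := by
    refine lt_of_eq_of_lt ?_ hj
    rw [div_eq_mul_inv, mul_pow, pow_succ]
    ring
  filter_upwards [h2.eventually (gt_mem_nhds (h3.trans_lt h4)),
    (Metric.tendsto_nhds.1 h1) _ (half_pos hη)] with n hn1 hn2
  rw [Real.dist_eq] at hn2
  have h5 : |monomerDensity (g n).graph x - average (g n).card fun v =>
      (ballClass (g n).graph (j + 1) v).density x| < η / 2 := by
    rw [monomerDensity_eq _ hx, ← average_sub]
    refine ((abs_average_le _).trans (average_mono fun v => ?_)).trans_lt hn1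
    exact abs_ratio_sub_density_le (g n).graph (j + 1) v hx
  calc _ ≤ _ := abs_sub_le _ (average (g n).card fun v =>
      (ballClass (g n).graph (j + 1) v).density x) _
    _ < η := by linarith

/-- With independent indices this gives the Cauchy property when `g = g'`, and otherwise equality of
limits. The limit need not be identified. -/
theorem tendsto_density_sub_of_large (hP : mean P ≠ ⊤) (hρ : mean ρ ≠ ⊤) {x : ℝ} (hx : 0 < x)
    (hxρ : (mean ρ).toReal < x ^ 2) (hg : GoodSeq P ρ g) (hg' : GoodSeq P ρ g') :
    Tendsto (fun p : ℕ × ℕ => monomerDensity (g p.1).graph x - monomerDensity (g' p.2).graph x)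
      (atTop ×ˢ atTop) (𝓝 0) := by
  rw [Metric.tendsto_nhds]
  intro η hη
  obtain ⟨L, hL⟩ := exists_approx_density (P := P) hP hρ hx hxρ (half_pos hη)
  filter_upwards [(hL g hg).prod_mk (hL g' hg')] with p hp
  obtain ⟨h1, h2⟩ := hp
  rw [dist_zero_right, Real.norm_eq_abs]
  rw [abs_lt] at *
  constructor <;> linarith

theorem sub_lt_re_of_mem_ball {X R : ℝ} {z : ℂ} (hz : z ∈ Metric.ball (X : ℂ) R) :
    X - R < z.re := by
  rw [Metric.mem_ball, dist_eq_norm] at hz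
  have h := (Complex.abs_re_le_norm _).trans_lt hz
  rw [Complex.sub_re, Complex.ofReal_re, abs_lt] at h
  linarith

/-- Vitali on a slightly larger disc of radius `R < X`, where densities are bounded by `(X + R) / (X
- R)`. The segment to the right of `X` consists of large activities, already settled. -/
theorem tendstoUniformlyOn_complexDensity_sub (hP : mean P ≠ ⊤) (hρ : mean ρ ≠ ⊤) {X r : ℝ}
    (hr : 0 < r) (hrX : r < X) (hXρ : (mean ρ).toReal < X ^ 2) (hg : GoodSeq P ρ g)
    (hg' : GoodSeq P ρ g') :
    TendstoUniformlyOn (fun (p : ℕ × ℕ) z =>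
      complexDensity (g p.1).graph z - complexDensity (g' p.2).graph z)
      (fun _ => 0) (atTop ×ˢ atTop) (Metric.closedBall (X : ℂ) r) := by
  obtain ⟨R, hrR, hRX⟩ := exists_between hrX
  have hX : 0 < X := hr.trans hrX
  have hbound : ∀ (h : FinGraph), ∀ z ∈ Metric.ball (X : ℂ) R,
      ‖complexDensity h.graph z‖ ≤ (X + R) * (X - R)⁻¹ := by
    intro h z hz
    have h1 := sub_lt_re_of_mem_ball hz
    have h2 : 0 < X - R := sub_pos.2 hRX
    refine (norm_complexDensity_le _ (h2.trans h1)).trans ?_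
    refine mul_le_mul ?_ (inv_anti₀ h2 h1.le) (inv_nonneg.2 (h2.trans h1).le) (by linarith)
    rw [Metric.mem_ball, dist_eq_norm] at hz
    calc ‖z‖ = ‖(X : ℂ) + (z - X)‖ := by rw [add_sub_cancel]
      _ ≤ ‖(X : ℂ)‖ + ‖z - X‖ := norm_add_le _ _
      _ ≤ X + R := by
        rw [Complex.norm_real, Real.norm_of_nonneg hX.le]
        linarith
  refine tendstoUniformlyOn_zero_of_bounded (C := (X + R) * (X - R)⁻¹ + (X + R) * (X - R)⁻¹)
    hr hrR one_pos ?_ ?_ ?_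
  · intro p z hz
    have h1 : 0 < z.re := (sub_pos.2 hRX).trans (sub_lt_re_of_mem_ball hz)
    exact ((differentiableAt_complexDensity _ h1).fun_sub
      (differentiableAt_complexDensity _ h1)).differentiableWithinAt
  · intro p z hz
    exact (norm_sub_le _ _).trans (add_le_add (hbound _ z hz) (hbound _ z hz))
  · intro t ht _
    have hXt : 0 < X + t := by positivity
    have h1 := tendsto_density_sub_of_large hP hρ hXt
      (hXρ.trans (pow_lt_pow_left₀ (by linarith) hX.le two_ne_zero)) hg hg'
    have h2 := (Complex.continuous_ofReal.tendsto 0).comp h1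
    rw [Complex.ofReal_zero] at h2
    refine h2.congr fun p => ?_
    rw [← Complex.ofReal_add, complexDensity_ofReal _ hXt, complexDensity_ofReal _ hXt,
      Function.comp_apply, Complex.ofReal_sub]

/-- A disc centered at a large activity that contains a neighbourhood of a given activity. -/
theorem exists_disc (m : ℝ) {x : ℝ} (hx : 0 < x) : ∃ X r : ℝ, 0 < r ∧ r < X ∧ m < X ^ 2 ∧
    (x : ℂ) ∈ Metric.ball (X : ℂ) r := by
  set X := max x (max m 1) + 1
  have h1 : x + 1 ≤ X := add_le_add_left (le_max_left _ _) 1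
  have h2 : m + 1 ≤ X := add_le_add_left ((le_max_left _ _).trans (le_max_right _ _)) 1
  have h3 : 1 + 1 ≤ X := add_le_add_left ((le_max_right _ _).trans (le_max_right _ _)) 1
  -- The disc reaches down to `x / 2` on the real axis.
  refine ⟨X, X - x / 2, by linarith, by linarith, by nlinarith, ?_⟩
  rw [Metric.mem_ball, dist_eq_norm, ← Complex.ofReal_sub, Complex.norm_real, Real.norm_eq_abs,
    abs_sub_comm, abs_of_pos (by linarith)]
  linarith

theorem tendsto_density_sub (hP : mean P ≠ ⊤) (hρ : mean ρ ≠ ⊤) {x : ℝ} (hx : 0 < x)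
    (hg : GoodSeq P ρ g) (hg' : GoodSeq P ρ g') :
    Tendsto (fun p : ℕ × ℕ => monomerDensity (g p.1).graph x - monomerDensity (g' p.2).graph x)
      (atTop ×ˢ atTop) (𝓝 0) := by
  obtain ⟨X, r, hr, hrX, hm, hmem⟩ := exists_disc (mean ρ).toReal hx
  have h := (tendstoUniformlyOn_complexDensity_sub hP hρ hr hrX hm hg hg').tendsto_at
    (Metric.ball_subset_closedBall hmem)
  have h2 := (Complex.continuous_re.tendsto 0).comp h
  rw [Complex.zero_re] at h2
  refine h2.congr fun p => ?_
  rw [Function.comp_apply, complexDensity_ofReal _ hx, complexDensity_ofReal _ hx,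
    ← Complex.ofReal_sub, Complex.ofReal_re]

theorem exists_tendsto_density (hP : mean P ≠ ⊤) (hρ : mean ρ ≠ ⊤) {x : ℝ} (hx : 0 < x)
    (hg : GoodSeq P ρ g) :
    ∃ e : ℝ, ∀ g', GoodSeq P ρ g' → Tendsto (fun n => monomerDensity (g' n).graph x) atTop (𝓝 e) := by
  have h : CauchySeq fun n => monomerDensity (g n).graph x := by
    rw [cauchySeq_iff_tendsto_dist_atTop_0, ← prod_atTop_atTop_eq]
    have := (tendsto_density_sub hP hρ hx hg hg).norm
    rw [norm_zero] at this
    exact this.congr fun p => (dist_eq_norm _ _).symm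
  obtain ⟨e, he⟩ := cauchySeq_tendsto_of_complete h
  refine ⟨e, fun g' hg' => ?_⟩
  have h1 := (tendsto_density_sub hP hρ hx hg hg').comp
    (tendsto_id.prodMk tendsto_id : Tendsto (fun n : ℕ => (n, n)) atTop (atTop ×ˢ atTop))
  have h2 := he.sub h1
  rw [sub_zero] at h2
  exact h2.congr fun n => sub_sub_cancel _ _

/-- The limiting monomer density extends to a holomorphic function. -/
theorem exists_holomorphic_extension (hP : mean P ≠ ⊤) (hρ : mean ρ ≠ ⊤) (hg : GoodSeq P ρ g)
    {e : ℝ → ℝ}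
    (he : ∀ x, 0 < x → Tendsto (fun n => monomerDensity (g n).graph x) atTop (𝓝 (e x)))
    {x : ℝ} (hx : 0 < x) :
    ∃ (E : ℂ → ℂ) (δ : ℝ), 0 < δ ∧ δ ≤ x ∧ DifferentiableOn ℂ E (Metric.ball (x : ℂ) δ) ∧
      ∀ t : ℝ, |t - x| < δ → E t = e t := by
  obtain ⟨X, r, hr, hrX, hm, hmem⟩ := exists_disc (mean ρ).toReal hx
  have h := tendstoUniformlyOn_complexDensity_sub hP hρ hr hrX hm hg hg
  have hcauchy : UniformCauchySeqOn (fun n z => complexDensity (g n).graph z) atTop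
      (Metric.ball (X : ℂ) r) := by
    intro u hu
    obtain ⟨ε, hε, hεu⟩ := Metric.mem_uniformity_dist.1 hu
    filter_upwards [Metric.tendstoUniformlyOn_iff.1 h ε hε] with p hp z hz
    refine hεu ?_
    have := hp z (Metric.ball_subset_closedBall hz)
    rwa [dist_zero_left, ← dist_eq_norm] at this
  have hex : ∀ z ∈ Metric.ball (X : ℂ) r, ∃ w,
      Tendsto (fun n => complexDensity (g n).graph z) atTop (𝓝 w) :=
    fun z hz => cauchySeq_tendsto_of_complete (hcauchy.cauchySeq hz)
  choose! E hE using hex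
  have hdiff : DifferentiableOn ℂ E (Metric.ball (X : ℂ) r) := by
    refine (hcauchy.tendstoUniformlyOn_of_tendsto hE).tendstoLocallyUniformlyOn.differentiableOn
      (Eventually.of_forall fun n z hz => ?_) Metric.isOpen_ball
    exact (differentiableAt_complexDensity _
      ((sub_pos.2 hrX).trans (sub_lt_re_of_mem_ball hz))).differentiableWithinAt
  obtain ⟨δ, hδ, hsub⟩ := Metric.isOpen_iff.1 Metric.isOpen_ball _ hmem
  refine ⟨E, min δ x, lt_min hδ hx, min_le_right _ _,
    hdiff.mono ((Metric.ball_subset_ball (min_le_left _ _)).trans hsub), fun t ht => ?_⟩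
  have ht0 : 0 < t := by
    have := (abs_lt.1 (ht.trans_le (min_le_right _ _))).1
    linarith
  have htmem : (t : ℂ) ∈ Metric.ball (X : ℂ) r := by
    refine hsub ?_
    rw [Metric.mem_ball, dist_eq_norm, ← Complex.ofReal_sub, Complex.norm_real, Real.norm_eq_abs]
    exact ht.trans_le (min_le_left _ _)
  refine tendsto_nhds_unique (hE _ htmem) ?_
  refine ((Complex.continuous_ofReal.tendsto _).comp (he t ht0)).congr fun n => ?_
  rw [Function.comp_apply, complexDensity_ofReal _ ht0]

end GoodSequences

/-! ### Real analyticity from holomorphic extensions. -/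

section Analyticity

open Filter Topology

theorem analyticAt_of_holomorphic_extension {f : ℝ → ℝ} {E : ℂ → ℂ} {x δ : ℝ} (hδ : 0 < δ)
    (hE : DifferentiableOn ℂ E (Metric.ball (x : ℂ) δ)) (hEf : ∀ t : ℝ, |t - x| < δ → E t = f t) :
    AnalyticAt ℝ f x := by
  have h1 : AnalyticAt ℝ E ((x : ℝ) : ℂ) :=
    (hE.analyticAt (Metric.ball_mem_nhds _ hδ)).restrictScalars
  have h2 : AnalyticAt ℝ (fun t : ℝ => (E (t : ℂ)).re) x :=
    (Complex.reCLM.analyticAt _).comp (h1.comp (Complex.ofRealCLM.analyticAt x))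
  refine h2.congr ?_
  filter_upwards [Metric.ball_mem_nhds x hδ] with t ht
  rw [hEf t (by rwa [Metric.mem_ball, Real.dist_eq] at ht), Complex.ofReal_re]

/-- A function whose derivative extends holomorphically is analytic. -/
theorem analyticAt_of_deriv_holomorphic_extension {f f' : ℝ → ℝ} {E : ℂ → ℂ} {x δ : ℝ}
    (hδ : 0 < δ) (hE : DifferentiableOn ℂ E (Metric.ball (x : ℂ) δ))
    (hEf : ∀ t : ℝ, |t - x| < δ → E t = f' t)
    (hf : ∀ t : ℝ, |t - x| < δ → HasDerivAt f (f' t) t) : AnalyticAt ℝ f x := by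
  -- On the real interval `f` differs by a constant from the real part of the primitive `W`.
  obtain ⟨W, hW⟩ := hE.isExactOn_ball
  have hmem : ∀ t : ℝ, |t - x| < δ → (t : ℂ) ∈ Metric.ball (x : ℂ) δ := by
    intro t ht
    rwa [Metric.mem_ball, dist_eq_norm, ← Complex.ofReal_sub, Complex.norm_real, Real.norm_eq_abs]
  have hWre : ∀ t : ℝ, |t - x| < δ → HasDerivAt (fun t : ℝ => (W t).re) (f' t) t := by
    intro t ht
    have h := (hW t (hmem t ht)).real_of_complex
    rwa [hEf t ht, Complex.ofReal_re] at h
  have hconst : ∀ t ∈ Metric.ball x δ, f t - (W t).re = f x - (W x).re := by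
    intro t ht
    have hd : ∀ s ∈ Metric.ball x δ, HasDerivAt (fun s => f s - (W s).re) 0 s := by
      intro s hs
      have hs' : |s - x| < δ := by rwa [Metric.mem_ball, Real.dist_eq] at hs
      have := (hf s hs').fun_sub (hWre s hs')
      rwa [sub_self] at this
    refine (convex_ball x δ).is_const_of_fderivWithin_eq_zero (𝕜 := ℝ) (f := fun s => f s - (W s).re)
      (fun s hs => (hd s hs).differentiableAt.differentiableWithinAt) (fun s hs => ?_) ht
      (Metric.mem_ball_self hδ)
    rw [fderivWithin_of_isOpen Metric.isOpen_ball hs]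
    ext
    simp [(hd s hs).deriv]
  have h1 : AnalyticAt ℝ W ((x : ℝ) : ℂ) := by
    refine AnalyticAt.restrictScalars (𝕜' := ℂ) (DifferentiableOn.analyticAt
      (s := Metric.ball (x : ℂ) δ) (fun z hz => ?_) (Metric.ball_mem_nhds _ hδ))
    exact (hW z hz).differentiableAt.differentiableWithinAt
  have h2 : AnalyticAt ℝ (fun t : ℝ => (W (t : ℂ)).re + (f x - (W x).re)) x :=
    ((Complex.reCLM.analyticAt _).comp (h1.comp (Complex.ofRealCLM.analyticAt x))).add
      analyticAt_const
  refine h2.congr ?_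
  filter_upwards [Metric.ball_mem_nhds x hδ] with t ht
  rw [← hconst t ht]
  ring

end Analyticity

/-! ### Positivity of the derivative of the limiting density. -/

section Positivity

open Filter Topology

variable {N : ℕ} {G : SimpleGraph (Fin N)} {q : RootedClass} {v : Fin N}

/-- The neighbours of `w` lie within distance 2 of `v`; hence the radius 2 in this part. -/
theorem card_nbrs_le_of_adj (hv : ballClass G 2 v = q) {w : Fin N} (hw : w = v ∨ G.Adj v w)
    (S : Finset (Fin N)) : (nbrs G S w).card ≤ q.rep.1 := by
  obtain ⟨φ, -⟩ := classOf_eq_iff.1 hv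
  have h1 : (ballVertices G v 2).ncard = q.rep.1 := by
    change Nat.card (ballVertices G v 2) = _
    rw [Nat.card_congr φ.toEquiv, Nat.card_eq_fintype_card, Fintype.card_fin]
  rw [← h1, ← Set.ncard_coe_finset]
  refine Set.ncard_le_ncard (fun u hu => ?_) (Set.toFinite _)
  have hwu : G.Adj w u := (mem_nbrs.1 (Finset.mem_coe.1 hu)).2
  have h2 : G.edist v w ≤ 1 := by
    rcases hw with rfl | hw
    · simp
    · exact (SimpleGraph.edist_eq_one_iff_adj.2 hw).le
  calc G.edist v u ≤ G.edist v w + G.edist w u := SimpleGraph.edist_triangle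
    _ ≤ 1 + 1 := add_le_add h2 (SimpleGraph.edist_eq_one_iff_adj.2 hwu).le
    _ = ((2 : ℕ) : ℕ∞) := by norm_num

theorem exists_adj_of_ballClass_eq (hv : ballClass G 2 v = q) (hq : ∃ w, q.graph.Adj q.root w) :
    ∃ w, G.Adj v w := by
  obtain ⟨φ, hφ⟩ := classOf_eq_iff.1 hv
  obtain ⟨w, hw⟩ := hq
  rw [← hφ, ← φ.apply_symm_apply w] at hw
  exact ⟨(φ.symm w).1, φ.map_adj_iff.1 hw⟩

/-- A lower bound for the derivative of a summand of the monomer density on `[x, 2 x]`. -/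
noncomputable def derivBound (m : ℕ) (x : ℝ) : ℝ := 2 * x * ((2 * x + m * x⁻¹)⁻¹ ^ 2) ^ 2

theorem derivBound_pos (m : ℕ) {x : ℝ} (hx : 0 < x) : 0 < derivBound m x := by
  unfold derivBound
  positivity

/-- In `le_deriv_mul_ratio` keep a single neighbour and bound both squared ratios below by
`le_ratio`. Uniformity on `[x, 2 x]` allows integration. -/
theorem derivBound_le (hv : ballClass G 2 v = q) (hq : ∃ w, q.graph.Adj q.root w) {x y : ℝ}
    (hx : 0 < x) (hxy : x ≤ y) (hy : y ≤ 2 * x) :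
    derivBound q.rep.1 x ≤ ratio G Finset.univ v y + y * deriv (ratio G Finset.univ v) y := by
  obtain ⟨w, hw⟩ := exists_adj_of_ballClass_eq hv hq
  have hy0 : 0 < y := hx.trans_le hxy
  have hbound : ∀ (u : Fin N) (S : Finset (Fin N)), u ∈ S → (u = v ∨ G.Adj v u) →
      (2 * x + q.rep.1 * x⁻¹)⁻¹ ≤ ratio G S u y := by
    intro u S hu huv
    refine (inv_anti₀ (by positivity) ?_).trans (le_ratio hu hy0)
    refine add_le_add hy (mul_le_mul ?_ (inv_anti₀ hx hxy) (by positivity) (Nat.cast_nonneg _))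
    exact Nat.cast_le.2 (card_nbrs_le_of_adj hv huv S)
  have hwS : w ∈ nbrs G Finset.univ v := mem_nbrs.2 ⟨Finset.mem_univ _, hw⟩
  have h1 := hbound v Finset.univ (Finset.mem_univ v) (Or.inl rfl)
  have h2 := hbound w (Finset.univ.erase v)
    (Finset.mem_erase.2 ⟨hw.ne', Finset.mem_univ _⟩) (Or.inr hw)
  have hpos : 0 ≤ (2 * x + q.rep.1 * x⁻¹)⁻¹ := by positivity
  refine le_trans ?_ (le_deriv_mul_ratio (Finset.mem_univ v) hy0)
  rw [derivBound, sq (_ ^ 2), ← mul_assoc]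
  refine mul_le_mul (mul_le_mul (by linarith) (pow_le_pow_left₀ hpos h1 2) (by positivity)
    (by positivity)) ?_ (by positivity) (by positivity)
  exact (pow_le_pow_left₀ hpos h2 2).trans (Finset.single_le_sum
    (f := fun w => ratio G (Finset.univ.erase v) w y ^ 2) (fun u _ => sq_nonneg _) hwS)

/-- Stated for increments, since these pass to the limit without convergence of derivatives. -/
theorem frequency_mul_le_density_sub (hq : ∃ w, q.graph.Adj q.root w) {x y : ℝ}
    (hx : 0 < x) (hxy : x ≤ y) (hy : y ≤ 2 * x) :
    (({v : Fin N | ballClass G 2 v = q} : Set _).ncard : ℝ) / N * derivBound q.rep.1 x * (y - x) ≤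
      monomerDensity G y - monomerDensity G x := by
  classical
  refine (convex_Icc x (2 * x)).mul_sub_le_image_sub_of_le_deriv
    (fun t ht => (hasDerivAt_monomerDensity G (hx.trans_le ht.1)).continuousAt.continuousWithinAt)
    (fun t ht => ?_) (fun t ht => ?_) x ⟨le_rfl, by linarith⟩ y ⟨hxy, hy⟩ hxy
  · rw [interior_Icc] at ht
    exact (hasDerivAt_monomerDensity G (hx.trans ht.1)).differentiableAt.differentiableWithinAt
  · rw [interior_Icc] at ht
    rw [(hasDerivAt_monomerDensity G (hx.trans ht.1)).deriv]
    have h1 : (({v : Fin N | ballClass G 2 v = q} : Set _).ncard : ℝ) / N * derivBound q.rep.1 x =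
        average N fun v => if ballClass G 2 v = q then derivBound q.rep.1 x else 0 := by
      rw [average, ← Finset.sum_filter, Finset.sum_const, nsmul_eq_mul, div_mul_eq_mul_div,
        ← Set.ncard_coe_finset]
      simp
    rw [h1]
    refine average_mono fun v => ?_
    split_ifs with hv
    · exact derivBound_le hv hq hx ht.1.le ht.2.le
    · exact (ratio_deriv_bounds (Finset.mem_univ v) (hx.trans ht.1)).1

variable {P ρ : PMF ℕ} {g : ℕ → FinGraph}

/-- The limiting monomer density has a positive derivative. -/
theorem deriv_limit_pos (hP : 0 < mean P) (hg : GoodSeq P ρ g) {e : ℝ → ℝ}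
    (he : ∀ x, 0 < x → Tendsto (fun n => monomerDensity (g n).graph x) atTop (𝓝 (e x)))
    {x : ℝ} (hx : 0 < x) (hd : DifferentiableAt ℝ e x) : 0 < deriv e x := by
  obtain ⟨K, hK, hpos⟩ := exists_treeClass_pos (ρ := ρ) one_le_two hP
  set q := treeClass 2 K
  set κ := (offspringLaw P ρ).real {K' | treeClass 2 K' = q} * derivBound q.rep.1 x
  have hκ : 0 < κ := mul_pos hpos (derivBound_pos _ hx)
  have hle : ∀ y, x ≤ y → y ≤ 2 * x → κ * (y - x) ≤ e y - e x := by
    intro y hxy hy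
    refine le_of_tendsto_of_tendsto' (((hg.freq 2 q ⟨K, rfl⟩).mul_const _).mul_const _)
      ((he y (hx.trans_le hxy)).sub (he x hx)) fun n => ?_
    exact frequency_mul_le_density_sub hK hx hxy hy
  refine hκ.trans_le ?_
  have hslope : Tendsto (slope e x) (𝓝[>] x) (𝓝 (deriv e x)) :=
    hd.hasDerivAt.tendsto_slope.mono_left (nhdsWithin_mono _ fun y hy => ne_of_gt hy)
  refine ge_of_tendsto hslope ?_
  filter_upwards [Ioo_mem_nhdsGT (show x < 2 * x by linarith)] with y hy
  rw [slope_def_field, le_div_iff₀ (sub_pos.2 hy.1)]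
  exact hle y hy.1.le hy.2.le

end Positivity

/-! ### Convergence and derivative of the limiting pressure. -/

section Pressure

open Filter Topology

variable {P ρ : PMF ℕ} {g : ℕ → FinGraph}

/-- The limiting pressure in terms of the limiting monomer density. -/
noncomputable def limitPressure (e : ℝ → ℝ) (x : ℝ) : ℝ :=
  Real.log x + ∫ t in Set.Ioi x, (1 - e t) / t

theorem GoodSeq.exists_density_bound (hg : GoodSeq P ρ g) : ∃ C : ℝ, ∀ᶠ n in atTop,
    (g n).card ≠ 0 ∧ ∀ t, 0 < t → 1 - monomerDensity (g n).graph t ≤ C * (t ^ 2)⁻¹ := by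
  obtain ⟨C, hC⟩ := hg.sparse
  refine ⟨C, ?_⟩
  filter_upwards [hC, hg.eventually_card_ne_zero] with n hn h0
  refine ⟨h0, fun t ht => (one_sub_monomerDensity_le _ h0 ht).trans ?_⟩
  exact mul_le_mul_of_nonneg_right hn (by positivity)

theorem integrableOn_mul_inv_sq_div (C : ℝ) {x : ℝ} (hx : 0 < x) :
    IntegrableOn (fun t => C * (t ^ 2)⁻¹ / t) (Set.Ioi x) := by
  have h := (integrableOn_Ioi_rpow_of_lt (a := -3) (by norm_num) hx).const_mul C
  refine IntegrableOn.congr_fun h (fun t ht => ?_) measurableSet_Ioi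
  have ht' : 0 < t := hx.trans ht
  rw [Real.rpow_neg ht'.le, div_eq_mul_inv, mul_assoc, ← mul_inv, ← pow_succ]
  norm_cast

/-- Dominated convergence with the majorant `C t⁻³` supplied by the bounded average degree. -/
theorem integrableOn_limit (hg : GoodSeq P ρ g) {e : ℝ → ℝ}
    (he : ∀ x, 0 < x → Tendsto (fun n => monomerDensity (g n).graph x) atTop (𝓝 (e x)))
    {x : ℝ} (hx : 0 < x) :
    IntegrableOn (fun t => (1 - e t) / t) (Set.Ioi x) ∧
    Tendsto (fun n => ∫ t in Set.Ioi x, (1 - monomerDensity (g n).graph t) / t) atTop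
      (𝓝 (∫ t in Set.Ioi x, (1 - e t) / t)) := by
  obtain ⟨C, hC⟩ := hg.exists_density_bound
  have hlim : ∀ t ∈ Set.Ioi x, Tendsto (fun n => (1 - monomerDensity (g n).graph t) / t) atTop
      (𝓝 ((1 - e t) / t)) := fun t ht =>
    ((he t (hx.trans ht)).const_sub 1).div_const t
  have hmeas : ∀ᶠ n in atTop, AEStronglyMeasurable
      (fun t => (1 - monomerDensity (g n).graph t) / t) (volume.restrict (Set.Ioi x)) := by
    filter_upwards [hC] with n hn
    exact (pressure_eq_integral _ hn.1 hx).1.aestronglyMeasurable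
  have hbound : ∀ᶠ n in atTop, ∀ t ∈ Set.Ioi x,
      ‖(1 - monomerDensity (g n).graph t) / t‖ ≤ C * (t ^ 2)⁻¹ / t := by
    filter_upwards [hC] with n hn t ht
    have ht' : 0 < t := hx.trans ht
    rw [Real.norm_of_nonneg
      (div_nonneg (sub_nonneg.2 (monomerDensity_le_one _ ht')) ht'.le)]
    exact div_le_div_of_nonneg_right (hn.2 t ht') ht'.le
  refine ⟨?_, tendsto_integral_filter_of_dominated_convergence (fun t => C * (t ^ 2)⁻¹ / t) hmeas
    ?_ (integrableOn_mul_inv_sq_div C hx) ?_⟩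
  · obtain ⟨n₀, hn₀⟩ := eventually_atTop.1 (hmeas.and hbound)
    refine Integrable.mono' (integrableOn_mul_inv_sq_div C hx)
      (aestronglyMeasurable_of_tendsto_ae atTop (fun n => (hn₀ (n + n₀) (by omega)).1)
        ((ae_restrict_iff' measurableSet_Ioi).2 (Eventually.of_forall fun t ht =>
          (tendsto_add_atTop_iff_nat n₀).2 (hlim t ht)))) ?_
    refine (ae_restrict_iff' measurableSet_Ioi).2 (Eventually.of_forall fun t ht => ?_)
    refine le_of_tendsto (hlim t ht).norm ?_
    filter_upwards [hbound] with n hn using hn t ht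
  · filter_upwards [hbound] with n hn
    exact (ae_restrict_iff' measurableSet_Ioi).2 (Eventually.of_forall hn)
  · exact (ae_restrict_iff' measurableSet_Ioi).2 (Eventually.of_forall hlim)

theorem tendsto_pressure (hg : GoodSeq P ρ g) {e : ℝ → ℝ}
    (he : ∀ x, 0 < x → Tendsto (fun n => monomerDensity (g n).graph x) atTop (𝓝 (e x)))
    {x : ℝ} (hx : 0 < x) :
    Tendsto (fun n => pressure (g n).graph x) atTop (𝓝 (limitPressure e x)) := by
  refine ((integrableOn_limit hg he hx).2.const_add (Real.log x)).congr' ?_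
  filter_upwards [hg.eventually_card_ne_zero] with n hn
  exact (pressure_eq_integral _ hn hx).2.symm

/-- Moving the base point to `x / 2` makes the varying part a proper integral; then `1 / x - (1 - e
x) / x = e x / x`. -/
theorem hasDerivAt_limitPressure {e : ℝ → ℝ} (hcont : ∀ x, 0 < x → ContinuousAt e x)
    (hint : ∀ x, 0 < x → IntegrableOn (fun t => (1 - e t) / t) (Set.Ioi x)) {x : ℝ} (hx : 0 < x) :
    HasDerivAt (limitPressure e) (e x / x) x := by
  have hx2 : 0 < x / 2 := by positivity
  have hii : ∀ y, x / 2 ≤ y →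
      IntervalIntegrable (fun t => (1 - e t) / t) volume (x / 2) y := fun y hy =>
    (intervalIntegrable_iff_integrableOn_Ioc_of_le hy).2
      ((hint _ hx2).mono_set Set.Ioc_subset_Ioi_self)
  have heq : limitPressure e =ᶠ[𝓝 x] fun y => Real.log y +
      ((∫ t in Set.Ioi (x / 2), (1 - e t) / t) - ∫ t in (x / 2)..y, (1 - e t) / t) := by
    filter_upwards [lt_mem_nhds (show x / 2 < x by linarith)] with y hy
    rw [limitPressure, ← intervalIntegral.integral_Ioi_sub_Ioi (hint _ hx2) hy.le, sub_sub_cancel]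
  have hc : ∀ y, 0 < y → ContinuousAt (fun t => (1 - e t) / t) y := fun y hy =>
    (continuousAt_const.sub (hcont y hy)).div continuousAt_id hy.ne'
  have hsm : StronglyMeasurableAtFilter (fun t => (1 - e t) / t) (𝓝 x) :=
    ContinuousOn.stronglyMeasurableAtFilter (s := Set.Ioi 0) isOpen_Ioi
      (fun y hy => (hc y hy).continuousWithinAt) x hx
  have h1 := intervalIntegral.integral_hasDerivAt_right (hii x (by linarith)) hsm (hc x hx)
  refine (((Real.hasDerivAt_log hx.ne').add (h1.const_sub _)).congr_of_eventuallyEq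
    heq).congr_deriv ?_
  field_simp
  ring

end Pressure

/-! ### Assembly of the limit functions and the almost sure statement. -/

section MainTheorem

open Filter Topology

theorem exists_limit_functions {P ρ : PMF ℕ} (hu : IsUnimodular P ρ) (h2 : secondMoment P < ⊤)
    (h0 : 0 < mean P) (hne : ∃ g, GoodSeq P ρ g) : ∃ ε p F : ℝ → ℝ,
      (∀ g, GoodSeq P ρ g → ∀ x : ℝ, 0 < x →
        Tendsto (fun n => monomerDensity (g n).graph x) atTop (𝓝 (ε x)) ∧
        Tendsto (fun n => pressure (g n).graph x) atTop (𝓝 (p x))) ∧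
      AnalyticOnNhd ℝ ε (Set.Ioi 0) ∧ (∀ x : ℝ, 0 < x → 0 < deriv ε x) ∧
      AnalyticOnNhd ℝ F (ε '' Set.Ioi 0) ∧ ∀ x : ℝ, 0 < x → p x = F (ε x) := by
  obtain ⟨g, hg⟩ := hne
  have hρ := mean_ne_top hu h2 h0
  have hex : ∀ x : ℝ, 0 < x → ∃ e : ℝ, ∀ g', GoodSeq P ρ g' →
      Tendsto (fun n => monomerDensity (g' n).graph x) atTop (𝓝 e) :=
    fun x hx => exists_tendsto_density hu.1 hρ hx hg
  choose! ε hε using hex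
  have hlim : ∀ x, 0 < x → Tendsto (fun n => monomerDensity (g n).graph x) atTop (𝓝 (ε x)) :=
    fun x hx => hε x hx g hg
  have hεan : ∀ x, 0 < x → AnalyticAt ℝ ε x := by
    intro x hx
    obtain ⟨E, δ, hδ, -, hE, hEε⟩ := exists_holomorphic_extension hu.1 hρ hg hlim hx
    exact analyticAt_of_holomorphic_extension hδ hE hEε
  have hderiv : ∀ x, 0 < x → 0 < deriv ε x := fun x hx =>
    deriv_limit_pos h0 hg hlim hx (hεan x hx).differentiableAt
  have hpan : ∀ x, 0 < x → AnalyticAt ℝ (limitPressure ε) x := by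
    intro x hx
    obtain ⟨E, δ, hδ, hδx, hE, hEε⟩ := exists_holomorphic_extension hu.1 hρ hg hlim hx
    -- The quotient `E z / z` is holomorphic because `δ ≤ x` keeps `0` out of the disc.
    refine analyticAt_of_deriv_holomorphic_extension (f' := fun t => ε t / t)
      (E := fun z => E z / z) hδ (hE.fun_div differentiableOn_id fun z hz h => ?_)
      (fun t ht => ?_) fun t ht => ?_
    · rw [Metric.mem_ball, dist_eq_norm] at hz
      rw [show z = 0 from h, zero_sub, norm_neg, Complex.norm_real, Real.norm_of_nonneg hx.le] at hz
      linarith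
    · rw [hEε t ht, Complex.ofReal_div]
    · exact hasDerivAt_limitPressure (fun y hy => (hεan y hy).continuousAt)
        (fun y hy => (integrableOn_limit hg hlim hy).1) (by linarith [(abs_lt.1 ht).1])
  have hinj : Set.InjOn ε (Set.Ioi 0) := by
    refine (strictMonoOn_of_deriv_pos (convex_Ioi 0)
      (fun x hx => (hεan x hx).continuousAt.continuousWithinAt) fun x hx => ?_).injOn
    rw [interior_Ioi] at hx
    exact hderiv x hx
  set F : ℝ → ℝ := fun y => limitPressure ε (Function.invFunOn ε (Set.Ioi 0) y)
  have hF : ∀ x, 0 < x → limitPressure ε x = F (ε x) := fun x hx =>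
    congrArg (limitPressure ε) (hinj.leftInvOn_invFunOn (Set.mem_Ioi.2 hx)).symm
  refine ⟨ε, limitPressure ε, F, fun g' hg' x hx => ⟨hε x hx g' hg',
    tendsto_pressure hg' (fun y hy => hε y hy g' hg') hx⟩, fun x hx => hεan x hx, hderiv, ?_, hF⟩
  rintro _ ⟨x, hx, rfl⟩
  -- As `ε` is locally invertible, analyticity of `F` at `ε x` is that of `F ∘ ε`, which is the
  -- pressure near `x`.
  rw [← analyticAt_comp_iff_of_deriv_ne_zero (hεan x hx) (hderiv x hx).ne']
  refine (hpan x hx).congr ?_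
  filter_upwards [lt_mem_nhds hx] with y hy using hF y hy

theorem ballFrequency_eq (G : FinGraph) (r : ℕ) (q : RootedClass) :
    ballFrequency G r q.graph q.root =
      (({v : Fin G.card | ballClass G.graph r v = q} : Set _).ncard : ℝ) / G.card := by
  classical
  rw [ballFrequency, ← Set.ncard_coe_finset]
  congr 3
  ext v
  simp only [Finset.coe_filter, Finset.mem_univ, true_and, Set.mem_ofPred_eq]
  exact classOf_eq_iff.symm

/-- Degrees below `l` contribute at most `l` to the average, the others less than `1`. -/
theorem average_card_nbrs_le {G : FinGraph} {l : ℕ} (h : highDegreeAverage G l < 1) :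
    (average G.card fun v => ((nbrs G.graph Finset.univ v).card : ℝ)) ≤ l + 1 := by
  classical
  rcases Nat.eq_zero_or_pos G.card with h0 | hpos
  · rw [average, show (G.card : ℝ) = 0 by rw [h0, Nat.cast_zero], div_zero]
    positivity
  rw [highDegreeAverage, ENNReal.div_lt_iff (Or.inl (Nat.cast_ne_zero.2 hpos.ne'))
    (Or.inl (ENNReal.natCast_ne_top _)), one_mul, Nat.cast_lt] at h
  rw [average, div_le_iff₀ (Nat.cast_pos.2 hpos)]
  have hdeg : ∀ v : Fin G.card, (nbrs G.graph Finset.univ v).card = G.graph.degree v := by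
    intro v
    rw [← SimpleGraph.card_neighborFinset_eq_degree]
    congr 1
    ext w
    simp [mem_nbrs]
  have h1 : ∑ v, (nbrs G.graph Finset.univ v).card ≤
      G.card * l + ∑ v, if l ≤ G.graph.degree v then G.graph.degree v else 0 := by
    have : G.card * l = ∑ _v : Fin G.card, l := by simp
    rw [this, ← Finset.sum_add_distrib]
    refine Finset.sum_le_sum fun v _ => ?_
    rw [hdeg]
    split_ifs <;> omega
  have h3 : ∑ v, (nbrs G.graph Finset.univ v).card ≤ (l + 1) * G.card := by
    refine h1.trans ?_
    convert (Nat.add_lt_add_left h (G.card * l)).le using 1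
    ring
  exact_mod_cast h3

/-- Only classes of truncated trees are needed. They are trees of at most `r` generations, so local
convergence applies to each, and countably many null sets are discarded. -/
theorem ae_goodSeq {Ω : Type*} [MeasurableSpace Ω] {μ : Measure Ω} {G : ℕ → Ω → FinGraph}
    {P ρ : PMF ℕ} (hlocal : LocallyConverges μ G P ρ) (hsparse : UniformlySparse μ G) :
    ∀ᵐ ω ∂μ, GoodSeq P ρ fun n => G n ω := by
  have h1 : ∀ᵐ ω ∂μ, ∀ (r : ℕ) (q : RootedClass), q ∈ Set.range (treeClass r) →
      Tendsto (fun n => ballFrequency (G n ω) r q.graph q.root) atTop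
        (𝓝 (truncatedTreeProb P ρ r q.graph q.root)) := by
    rw [ae_all_iff]
    intro r
    rw [ae_all_iff]
    intro q
    by_cases hq : q ∈ Set.range (treeClass r)
    · obtain ⟨K, rfl⟩ := hq
      filter_upwards [hlocal r _ _ _ (treeClass_isTree r K).1 (treeClass_isTree r K).2] with ω hω _
        using hω
    · exact Eventually.of_forall fun ω h => absurd h hq
  filter_upwards [h1, hsparse] with ω hω1 hω2
  refine ⟨fun r q hq => ?_, ?_⟩
  · have h := hω1 r q hq
    simp_rw [ballFrequency_eq] at h
    convert h using 2
    rw [truncatedTreeProb]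
    congr 1
    ext K
    exact classOf_eq_iff
  · obtain ⟨l, hl⟩ := (hω2.eventually (gt_mem_nhds one_pos)).exists
    refine ⟨l + 1, ?_⟩
    filter_upwards [eventually_lt_of_limsup_lt hl] with n hn using average_card_nbrs_le hn

end MainTheorem

end MonomerDimer

theorem mainTheorem6 {Ω : Type*} [MeasurableSpace Ω] (μ : MeasureTheory.Measure Ω)
    [MeasureTheory.IsProbabilityMeasure μ]
    (G : ℕ → Ω → MonomerDimer.FinGraph) (hG : ∀ n, Measurable (G n))
    (P ρ : PMF ℕ) (hunimodular : MonomerDimer.IsUnimodular P ρ)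
    (hlocal : MonomerDimer.LocallyConverges μ G P ρ)
    (hmoment : MonomerDimer.secondMoment P < ⊤)
    (hsparse : MonomerDimer.UniformlySparse μ G)
    (hmean : 0 < MonomerDimer.mean P) :
    ∃ ε p F : ℝ → ℝ,
      (∀ᵐ ω ∂μ, ∀ x : ℝ, 0 < x →
        Filter.Tendsto (fun n => MonomerDimer.monomerDensity (G n ω).graph x)
          Filter.atTop (nhds (ε x)) ∧
        Filter.Tendsto (fun n => MonomerDimer.pressure (G n ω).graph x)
          Filter.atTop (nhds (p x))) ∧
      AnalyticOnNhd ℝ ε (Set.Ioi 0) ∧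
      (∀ x : ℝ, 0 < x → 0 < deriv ε x) ∧
      AnalyticOnNhd ℝ F (ε '' Set.Ioi 0) ∧
      ∀ x : ℝ, 0 < x → p x = F (ε x) := by
  have hae := MonomerDimer.ae_goodSeq hlocal hsparse
  -- An almost sure event is nonempty; one good realisation defines the deterministic limits, which
  -- all good realisations share.
  obtain ⟨ω₀, hω₀⟩ := hae.exists
  obtain ⟨ε, p, F, hlim, h⟩ :=
    MonomerDimer.exists_limit_functions hunimodular hmoment hmean ⟨_, hω₀⟩
  refine ⟨ε, p, F, ?_, h⟩
  filter_upwards [hae] with ω hω using hlim _ hω
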